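/- For matrices put $X^{\#}=(\overline{X_{ij}})$, $\Delta(X,Y)=\begin{pmatrix}X&Y\\Y^{\#}&X^{\#}\end{pmatrix}$, $J_k=\mathrm{diag}(\mathbb 1_k,-\mathbb 1_k)$ and $Z^\flat=J_lZ^\dagger J_k$ for a $2k\times 2l$ matrix $Z$; a square complex matrix $T=\Delta(T_-,T_+)$ is symplectic if $T^\flat T=TT^\flat=\mathbb 1$. A covariance matrix $P$ of $k$ modes has symplectic eigenvalues $\nu_1,\dots,\nu_k$ if $TPT^\dagger=\mathrm{diag}(\nu_1+1,\dots,\nu_k+1,\nu_1,\dots,\nu_k)$ for some symplectic $T$; the state is pure if all $\nu_i=0$, and fully mixed if all $\nu_i>0$. A quantum linear system (QLS) with $m$ channels and $n$ modes is given by a symplectic matrix $S$ (static scattering/squeezing), $C=\Delta(C_-,C_+)$ and $\Omega=\Delta(\Omega_-,\Omega_+)$, where $C_\pm\in\mathbb C^{m\times n}$, $\Omega_-=\Omega_-^\dagger$, $\Omega_+=\Omega_+^T$. Put $\breve A=-\tfrac12C^\flat C-iJ_n\Omega$ and $\Xi(s)=\big(\mathbb 1-C(s-\breve A)^{-1}C^\flat\big)S$.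 All systems are assumed Hurwitz: the eigenvalues of $\breve A$ have negative real part. For the input covariance $V=V(N,M)=\begin{pmatrix}N^T+\mathbb 1&M\\M^\dagger&N\end{pmatrix}$ the power spectrum is the rational function $\Psi_V(s)=\Xi(s)V\,\Xi(-\bar s)^\dagger$, and the covariance $P$ of the stationary state is the solution of $\breve AP+P\breve A^\dagger+C^\flat SVS^\dagger(C^\flat)^\dagger=0$. A system is globally minimal for $V$ if no (Hurwitz) QLS with fewer modes has the same power spectrum $\Psi_V$. A passive SISO system $(C,\Omega)$ with $n$ modes consists of $C\in\mathbb C^{1\times n}$ and a Hermitian $\Omega\in\mathbb C^{n\times n}$; it is the QLS with $m=1$, $S=\mathbb 1$, $C_-=C$, $\Omega_-=\Omega$, $C_+=0$, $\Omega_+=0$. Put $A=-i\Omega-\tfrac12C^\dagger C$. The series product of $(C_1,\Omega_1)$ followed by $(C_2,\Omega_2)$ is the system with $C=(C_1,C_2)$ and $\Omega=\begin{pmatrix}\Omega_1&-\frac1{2i}C_1^\dagger C_2\\ \frac1{2i}C_2^\dagger C_1&\Omega_2\end{pmatrix}$. **Theorem.** Let $(C,\Omega)$ be a Hurwitz passive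 SISO system, and let the input be pure with covariance $V(N,M)$, where $M\neq0$. 1) The following are equivalent: i) the system is globally minimal for $V(N,M)$; ii) its stationary state is fully mixed; iii) $\sigma(A)\cap\sigma(A^\dagger)=\emptyset$; iv) $A$ has no real eigenvalue and no pair of complex conjugate eigenvalues. 2) List the eigenvalues of $A$ with algebraic multiplicity, and remove from the list all real eigenvalues and as many pairs $\{\lambda,\bar\lambda\}$ as possible, so that a non-real $\lambda$ remains $\max(0,\operatorname{mult}(\lambda)-\operatorname{mult}(\bar\lambda))$ times. Then the series product, in any order, of the one-mode systems with $c_i=\sqrt{2|\mathrm{Re}\,\lambda_i|}$ and $\Omega_i=-\mathrm{Im}\,\lambda_i$ over the remaining $\lambda_i$ is a globally minimal realisation of the system: it is Hurwitz, has the same power spectrum for $V(N,M)$ as the original system, and is globally minimal for $V(N,M)$. -/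

import Mathlib

noncomputable section

open Matrix ComplexConjugate

namespace QuantumLinear

/-- The entrywise complex conjugate `X^#` of a matrix. -/
def conjMat {k l : ℕ} (X : Matrix (Fin k) (Fin l) ℂ) : Matrix (Fin k) (Fin l) ℂ :=
  X.map (starRingEnd ℂ)

/-- The doubled-up matrix `Δ(A, B) = [A, B; B^#, A^#]`. -/
def dbl {k l : ℕ} (A B : Matrix (Fin k) (Fin l) ℂ) :
    Matrix (Fin k ⊕ Fin k) (Fin l ⊕ Fin l) ℂ :=
  fromBlocks A B (conjMat B) (conjMat A)

/-- `J = [1, 0; 0, -1]`, with blocks of size `k`. -/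
def signJ (k : ℕ) : Matrix (Fin k ⊕ Fin k) (Fin k ⊕ Fin k) ℂ :=
  fromBlocks 1 0 0 (-1)

/-- `Z^♭ = J Z† J`. -/
def flat {k l : ℕ} (Z : Matrix (Fin k ⊕ Fin k) (Fin l ⊕ Fin l) ℂ) :
    Matrix (Fin l ⊕ Fin l) (Fin k ⊕ Fin k) ℂ :=
  signJ l * Zᴴ * signJ k

/-- Symplectic matrices: `♭`-unitary matrices of doubled-up form. -/
def IsSymplectic {k : ℕ} (T : Matrix (Fin k ⊕ Fin k) (Fin k ⊕ Fin k) ℂ) : Prop :=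
  (∃ A B : Matrix (Fin k) (Fin k) ℂ, T = dbl A B) ∧ flat T * T = 1 ∧ T * flat T = 1

/-- `ν` lists the symplectic eigenvalues (mean photon numbers) of the covariance matrix
`P = ⟨c c†⟩` of a mean-zero Gaussian state of `k` modes: in a canonical basis `c' = T c` the modes
are independent, the `i`-th one having covariance `[ν i + 1, 0; 0, ν i]`. -/
def HasSymplecticEigenvalues {k : ℕ} (P : Matrix (Fin k ⊕ Fin k) (Fin k ⊕ Fin k) ℂ)
    (ν : Fin k → ℝ) : Prop :=
  ∃ T, IsSymplectic T ∧
    T * P * Tᴴ = fromBlocks (diagonal fun i => (ν i : ℂ) + 1) 0 0 (diagonal fun i => (ν i : ℂ))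

/-- A Gaussian state is pure if all its symplectic eigenvalues vanish. -/
def IsPure {k : ℕ} (P : Matrix (Fin k ⊕ Fin k) (Fin k ⊕ Fin k) ℂ) : Prop :=
  ∃ ν, HasSymplecticEigenvalues P ν ∧ ∀ i, ν i = 0

/-- A Gaussian state is fully mixed if all its symplectic eigenvalues are positive. -/
def IsFullyMixed {k : ℕ} (P : Matrix (Fin k ⊕ Fin k) (Fin k ⊕ Fin k) ℂ) : Prop :=
  ∃ ν, HasSymplecticEigenvalues P ν ∧ ∀ i, 0 < ν i

/-- The input covariance `V(N, M) = [Nᵀ + 1, M; M†, N]`. -/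
def inputCov {m : ℕ} (N M : Matrix (Fin m) (Fin m) ℂ) :
    Matrix (Fin m ⊕ Fin m) (Fin m ⊕ Fin m) ℂ :=
  fromBlocks (Nᵀ + 1) M Mᴴ N

/-- A quantum linear system with `m` input channels and `n` modes: static scattering/squeezing
`S = Δ(Sm, Sp)` acting on the input, coupling `L = Cm a + Cp a^#` and hamiltonian
`H = a† Ωm a + ½ aᵀ Ωp† a + ½ a† Ωp a^#`. -/
structure QLS (m n : ℕ) where
  Sm : Matrix (Fin m) (Fin m) ℂ
  Sp : Matrix (Fin m) (Fin m) ℂ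
  Cm : Matrix (Fin m) (Fin n) ℂ
  Cp : Matrix (Fin m) (Fin n) ℂ
  Ωm : Matrix (Fin n) (Fin n) ℂ
  Ωp : Matrix (Fin n) (Fin n) ℂ
  symplectic_S : IsSymplectic (dbl Sm Sp)
  hermitian_Ωm : Ωmᴴ = Ωm
  symmetric_Ωp : Ωpᵀ = Ωp

namespace QLS

variable {m n : ℕ}

/-- The doubled-up scattering/squeezing matrix. -/
def S (G : QLS m n) : Matrix (Fin m ⊕ Fin m) (Fin m ⊕ Fin m) ℂ := dbl G.Sm G.Sp

/-- The doubled-up coupling matrix. -/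
def C (G : QLS m n) : Matrix (Fin m ⊕ Fin m) (Fin n ⊕ Fin n) ℂ := dbl G.Cm G.Cp

/-- The doubled-up hamiltonian matrix. -/
def Ω (G : QLS m n) : Matrix (Fin n ⊕ Fin n) (Fin n ⊕ Fin n) ℂ := dbl G.Ωm G.Ωp

/-- The doubled-up drift matrix `A = -½ C^♭ C - i J Ω`. -/
def A (G : QLS m n) : Matrix (Fin n ⊕ Fin n) (Fin n ⊕ Fin n) ℂ :=
  -((1 / 2 : ℂ) • (flat G.C * G.C)) - Complex.I • (signJ n * G.Ω)

/-- Hurwitz stability. -/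
def IsHurwitz (G : QLS m n) : Prop := ∀ z ∈ spectrum ℂ G.A, z.re < 0

/-- The transfer function `Ξ(s) = (1 - C (s - A)⁻¹ C^♭) S`; meaningful for `s ∉ σ(A)`. -/
def transfer (G : QLS m n) (s : ℂ) : Matrix (Fin m ⊕ Fin m) (Fin m ⊕ Fin m) ℂ :=
  (1 - G.C * (s • (1 : Matrix (Fin n ⊕ Fin n) (Fin n ⊕ Fin n) ℂ) - G.A)⁻¹ * flat G.C) * G.S

/-- The power spectrum `Ψ_V(s) = Ξ(s) V Ξ(-s^#)†`; meaningful for `s` and `-s^#` outside `σ(A)`. -/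
def powerSpectrum (G : QLS m n) (V : Matrix (Fin m ⊕ Fin m) (Fin m ⊕ Fin m) ℂ) (s : ℂ) :
    Matrix (Fin m ⊕ Fin m) (Fin m ⊕ Fin m) ℂ :=
  G.transfer s * V * (G.transfer (-conj s))ᴴ

/-- `Ψ_V(s)` is defined at `s`. -/
def IsRegularAt (G : QLS m n) (s : ℂ) : Prop :=
  s ∉ spectrum ℂ G.A ∧ -conj s ∉ spectrum ℂ G.A

/-- Two systems have the same power spectrum for the input covariance `V`: their power spectra
agree (as rational functions of `s`), that is, at every `s` at which both are defined. -/
def SamePowerSpectrum {n' : ℕ} (V : Matrix (Fin m ⊕ Fin m) (Fin m ⊕ Fin m) ℂ)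
    (G : QLS m n) (G' : QLS m n') : Prop :=
  ∀ s : ℂ, G.IsRegularAt s → G'.IsRegularAt s → G.powerSpectrum V s = G'.powerSpectrum V s

/-- Global minimality for the input covariance `V`: no (stable) quantum linear system, active or
passive, with fewer modes has the same power spectrum. -/
def IsGloballyMinimal (G : QLS m n) (V : Matrix (Fin m ⊕ Fin m) (Fin m ⊕ Fin m) ℂ) : Prop :=
  ∀ n' < n, ∀ G' : QLS m n', G'.IsHurwitz → ¬ SamePowerSpectrum V G G'

/-- `P` is the covariance of the stationary state for input covariance `V`: it solves the Lyapunov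
equation, in which the field reaching the modes has covariance `S V S†`. For a Hurwitz system the
solution exists and is unique. -/
def IsStationaryCov (G : QLS m n) (V : Matrix (Fin m ⊕ Fin m) (Fin m ⊕ Fin m) ℂ)
    (P : Matrix (Fin n ⊕ Fin n) (Fin n ⊕ Fin n) ℂ) : Prop :=
  G.A * P + P * G.Aᴴ + flat G.C * (G.S * V * G.Sᴴ) * (flat G.C)ᴴ = 0

/-- The stationary state for the input covariance `V` is fully mixed. -/
def HasFullyMixedStationaryState (G : QLS m n)
    (V : Matrix (Fin m ⊕ Fin m) (Fin m ⊕ Fin m) ℂ) : Prop :=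
  ∃ P, G.IsStationaryCov V P ∧ IsFullyMixed P

end QLS

lemma isSymplectic_one (m : ℕ) :
    IsSymplectic (dbl (1 : Matrix (Fin m) (Fin m) ℂ) (0 : Matrix (Fin m) (Fin m) ℂ)) := by
  have h : dbl (1 : Matrix (Fin m) (Fin m) ℂ) (0 : Matrix (Fin m) (Fin m) ℂ) = 1 := by
    simp [dbl, conjMat, Matrix.map_one]
  have hJ : signJ m * signJ m = 1 := by
    simp [signJ, fromBlocks_multiply]
  refine ⟨⟨1, 0, rfl⟩, ?_, ?_⟩ <;> simp [h, flat, hJ]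

/-- A passive quantum linear system `(C, Ω)` with trivial scattering matrix: coupling `L = C a`,
hamiltonian `H = a† Ω a`. -/
structure PassiveQLS (m n : ℕ) where
  C : Matrix (Fin m) (Fin n) ℂ
  Ω : Matrix (Fin n) (Fin n) ℂ
  hermitian : Ωᴴ = Ω

namespace PassiveQLS

variable {m n : ℕ}

/-- A passive system as a quantum linear system: `S = 1`, `C₊ = 0`, `Ω₊ = 0`. -/
def toQLS (G : PassiveQLS m n) : QLS m n where
  Sm := 1
  Sp := 0
  Cm := G.C
  Cp := 0
  Ωm := G.Ω
  Ωp := 0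
  symplectic_S := isSymplectic_one m
  hermitian_Ωm := G.hermitian
  symmetric_Ωp := by simp

/-- The `n × n` matrix `A = -iΩ - ½ C† C`. -/
def A (G : PassiveQLS m n) : Matrix (Fin n) (Fin n) ℂ :=
  -(Complex.I • G.Ω) - (1 / 2 : ℂ) • (G.Cᴴ * G.C)

/-- The series product `G₂ ◁ G₁` (the output of `G₁` is the input of `G₂`), with the modes of `G₁`
listed first: `C = (C₁, C₂)` and `Ω = Ω₁ ⊕ Ω₂ + (X - X†) / 2i`, where `X` has the single non-zero
block `C₂† C₁`. -/
def series {n₁ n₂ : ℕ} (G₂ : PassiveQLS m n₂) (G₁ : PassiveQLS m n₁) :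
    PassiveQLS m (n₁ + n₂) where
  C := (fromCols G₁.C G₂.C).submatrix id finSumFinEquiv.symm
  Ω := (fromBlocks G₁.Ω (-((1 / (2 * Complex.I)) • (G₁.Cᴴ * G₂.C)))
      ((1 / (2 * Complex.I)) • (G₂.Cᴴ * G₁.C)) G₂.Ω).submatrix
      finSumFinEquiv.symm finSumFinEquiv.symm
  hermitian := by
    rw [conjTranspose_submatrix, fromBlocks_conjTranspose, G₁.hermitian, G₂.hermitian]
    simp [conjTranspose_smul, conjTranspose_mul, Complex.conj_I]

/-- The system without modes. -/
def empty (m : ℕ) : PassiveQLS m 0 where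
  C := 0
  Ω := 0
  hermitian := by simp

/-- The one-mode system with `c = √(2 |Re z|)` and `Ω = -Im z`. -/
def oneMode (z : ℂ) : PassiveQLS 1 1 where
  C := of fun _ _ => (Real.sqrt (2 * |z.re|) : ℂ)
  Ω := of fun _ _ => (-z.im : ℂ)
  hermitian := by
    ext i j
    simp [conjTranspose_apply]

/-- The series product `G_{z₁} ◁ (G_{z₂} ◁ ⋯)` of the one-mode systems belonging to the
entries of a list. -/
def cascade : (l : List ℂ) → PassiveQLS 1 l.length
  | [] => empty 1
  | z :: l => series (oneMode z) (cascade l)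

end PassiveQLS

/-- The eigenvalues of `A`, listed with algebraic multiplicity, that are left after all real
eigenvalues and all pairs `{z, conj z}` of eigenvalues have been removed. By the definition of
subtraction of multisets, `z` occurs in it as many times as the multiplicity of `z` exceeds that of
`conj z`, and not at all otherwise; in particular a real `z` never occurs. -/
def unpairedEigenvalues {n : ℕ} (A : Matrix (Fin n) (Fin n) ℂ) : Multiset ℂ :=
  A.charpoly.roots - A.charpoly.roots.map (starRingEnd ℂ)

end QuantumLinear

end

/-! Let `R` be the multiset of eigenvalues of `A`. With one channel, the transfer function of a
passive system is the all-pass function `∏ (s + conj z) / (s - z)` over `R` (`passiveTransfer_eq`).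
Hence the diagonal of the power spectrum is that of the input, while the entry `M` is multiplied by
`∏ (s² - conj z²) / (s² - z²)` (`powerSpectrum_eq`). A conjugation-invariant part of `R` contributes
the factor 1, so a cascade over `R - conj R` has the same spectrum, with fewer modes as soon as `R`
meets `conj R`. If they do not meet, nothing cancels: the two off-diagonal entries have poles at `R`
and at `conj R` in the left half-plane, `2n` in all. Each is a root of the characteristic
polynomial, of degree `2n'`, of any Hurwitz realisation with `n'` modes
(`prod_X_sub_C_dvd_charpoly`), so `n ≤ n'`.

For mixedness, purity means `N = r`, `M = g` with `|g|² = r(r + 1)`. The stationary covariance is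
then `[r + 1, g Y; conj g Y†, r]`, where `Y` is symmetric and solves `A Y + Y Aᵀ = -C† C^#`. Takagi
factorisation of `Y` splits it into independent modes `[r + 1, g dᵢ; conj g dᵢ, r]`, which are mixed
when `dᵢ² < 1`. Since `1 - Y Y†` solves a Lyapunov equation for `A`, an eigenvalue of `Y Y†` that is
at least 1 forces eigenvalues `μ`, `conj μ` of `A` (`exists_mem_of_one_le`). Conversely such a pair
produces a null vector of the covariance (`exists_exchanged_of_mem`, `not_isFullyMixed_covOf`). -/

namespace QuantumLinear

open Matrix ComplexConjugate Polynomial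

/-! ### Eigenvalues under conjugation, and determinants as products over them. -/

section Spectrum

variable {n : ℕ}

lemma mem_spectrum_iff_mem_roots {ι : Type*} [Fintype ι] [DecidableEq ι] (A : Matrix ι ι ℂ)
    (z : ℂ) : z ∈ spectrum ℂ A ↔ z ∈ A.charpoly.roots := by
  rw [Matrix.mem_spectrum_iff_isRoot_charpoly, mem_roots A.charpoly_monic.ne_zero]

lemma conjMat_conjTranspose {k l : ℕ} (X : Matrix (Fin k) (Fin l) ℂ) : (conjMat X)ᴴ = Xᵀ := by
  ext i j
  simp [conjMat]

lemma conjMat_mul {k l r : ℕ} (X : Matrix (Fin k) (Fin l) ℂ) (Y : Matrix (Fin l) (Fin r) ℂ) :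
    conjMat (X * Y) = conjMat X * conjMat Y :=
  Matrix.map_mul

lemma conjTranspose_eq_transpose_conjMat {k l : ℕ} (X : Matrix (Fin k) (Fin l) ℂ) :
    Xᴴ = (conjMat X)ᵀ := by
  ext i j
  simp [conjMat]

lemma charpoly_conjMat_roots (A : Matrix (Fin n) (Fin n) ℂ) :
    (conjMat A).charpoly.roots = A.charpoly.roots.map (starRingEnd ℂ) := by
  have h : (conjMat A).charpoly = A.charpoly.map (starRingEnd ℂ) := by
    rw [conjMat, Matrix.charpoly_map]
  rw [h]
  exact ((IsAlgClosed.splits A.charpoly).roots_map _)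

lemma charpoly_conjTranspose_roots (A : Matrix (Fin n) (Fin n) ℂ) :
    Aᴴ.charpoly.roots = A.charpoly.roots.map (starRingEnd ℂ) := by
  rw [conjTranspose_eq_transpose_conjMat, Matrix.charpoly_transpose, charpoly_conjMat_roots]

lemma charpoly_eval_eq_prod {ι : Type*} [Fintype ι] [DecidableEq ι] (A : Matrix ι ι ℂ) (s : ℂ) :
    A.charpoly.eval s = (A.charpoly.roots.map fun z => s - z).prod := by
  conv_lhs => rw [(IsAlgClosed.splits A.charpoly).eq_prod_roots_of_monic A.charpoly_monic]
  rw [eval_multiset_prod, Multiset.map_map]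
  simp

lemma det_smul_one_sub {ι : Type*} [Fintype ι] [DecidableEq ι] (A : Matrix ι ι ℂ) (s : ℂ) :
    (s • (1 : Matrix ι ι ℂ) - A).det = (A.charpoly.roots.map fun z => s - z).prod := by
  rw [← charpoly_eval_eq_prod, Matrix.eval_charpoly, Matrix.scalar_apply,
    ← Matrix.smul_one_eq_diagonal]

end Spectrum

lemma fromBlocks_sub {α β : Type*} (A B C D A' B' C' D' : Matrix α β ℂ) :
    fromBlocks A B C D - fromBlocks A' B' C' D'
      = fromBlocks (A - A') (B - B') (C - C') (D - D') := by
  simp only [sub_eq_add_neg, fromBlocks_neg, fromBlocks_add]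

/-! ### All-pass functions and the squeezing factor. -/

section AllPass

/-- The all-pass function `∏ (s + conj z) / (s - z)`. -/
noncomputable def allPass (R : Multiset ℂ) (s : ℂ) : ℂ :=
  (R.map fun z => (s + conj z) / (s - z)).prod

/-- The function `∏ (s² - (conj z)²) / (s² - z²)`. -/
noncomputable def squeezing (R : Multiset ℂ) (s : ℂ) : ℂ :=
  (R.map fun z => (s ^ 2 - conj z ^ 2) / (s ^ 2 - z ^ 2)).prod

lemma allPass_mul_allPass_neg (R : Multiset ℂ) (s : ℂ) :
    allPass R s * allPass R (-s) = squeezing R s := by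
  rw [allPass, allPass, squeezing, ← Multiset.prod_map_mul]
  refine congrArg _ (Multiset.map_congr rfl fun z _ => ?_)
  rw [div_mul_div_comm, ← neg_div_neg_eq]
  congr 1 <;> ring

lemma conj_allPass (R : Multiset ℂ) (s : ℂ) :
    conj (allPass R s) = allPass (R.map (starRingEnd ℂ)) (conj s) := by
  rw [allPass, allPass, map_multiset_prod, Multiset.map_map, Multiset.map_map]
  refine congrArg _ (Multiset.map_congr rfl fun z _ => ?_)
  simp

lemma allPass_mul_conj (R : Multiset ℂ) (s : ℂ) (h₁ : s ∉ R) (h₂ : -conj s ∉ R) :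
    allPass R s * conj (allPass R (-conj s)) = 1 := by
  rw [conj_allPass, allPass, allPass, Multiset.map_map, ← Multiset.prod_map_mul]
  refine Multiset.prod_eq_one fun x hx => ?_
  obtain ⟨z, hz, rfl⟩ := Multiset.mem_map.1 hx
  have h3 : s - z ≠ 0 := fun h => h₁ (by rwa [sub_eq_zero.1 h])
  have h4 : s + conj z ≠ 0 := fun h => h₂ (by
    have : -conj s = z := by rw [eq_neg_of_add_eq_zero_left h]; simp
    rwa [this])
  have h5 : -s - conj z ≠ 0 := fun h => h4 (by linear_combination -h)
  simp only [Function.comp_apply, map_neg, Complex.conj_conj]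
  field_simp
  ring

lemma squeezing_add (R R' : Multiset ℂ) (s : ℂ) :
    squeezing (R + R') s = squeezing R s * squeezing R' s := by
  simp [squeezing]

/-- Conjugation permutes the factors, so numerator and denominator are the same product; the two
exclusions keep the denominator non-zero. -/
lemma squeezing_eq_one {R : Multiset ℂ} (hR : R.map (starRingEnd ℂ) = R) {s : ℂ}
    (h₁ : s ∉ R) (h₂ : -s ∉ R) : squeezing R s = 1 := by
  have hp : (R.map fun z => s ^ 2 - conj z ^ 2).prod = (R.map fun z => s ^ 2 - z ^ 2).prod := by
    conv_rhs => rw [← hR, Multiset.map_map]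
    rfl
  rw [squeezing, Multiset.prod_map_div, hp, div_self]
  refine Multiset.prod_ne_zero fun h => ?_
  obtain ⟨z, hz, h0⟩ := Multiset.mem_map.1 h
  rcases sq_eq_sq_iff_eq_or_eq_neg.1 (sub_eq_zero.1 h0) with h | h
  · exact h₁ (h ▸ hz)
  · exact h₂ (by rwa [h, neg_neg])

end AllPass

/-! ### Transfer function and power spectrum of a passive system. -/

namespace PassiveQLS

variable {m n : ℕ}

lemma A_add_conjTranspose (G : PassiveQLS m n) : G.A + G.Aᴴ = -(G.Cᴴ * G.C) := by
  simp only [A, conjTranspose_sub, conjTranspose_neg, conjTranspose_smul, G.hermitian,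
    conjTranspose_mul, conjTranspose_conjTranspose]
  ext i j
  simp only [one_div, RCLike.star_def, Complex.conj_I, neg_smul, neg_neg, star_inv₀, star_ofNat,
    Matrix.add_apply, Matrix.sub_apply, Matrix.neg_apply, Matrix.smul_apply, smul_eq_mul]
  ring

/-- The system `(C^#, -Ω^#)`, with drift matrix `A^#`. -/
noncomputable def conjSystem (G : PassiveQLS m n) : PassiveQLS m n where
  C := conjMat G.C
  Ω := -conjMat G.Ω
  hermitian := by
    rw [conjTranspose_neg, conjMat_conjTranspose, ← G.hermitian,
      conjTranspose_eq_transpose_conjMat, Matrix.transpose_transpose,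
      ← conjTranspose_eq_transpose_conjMat, G.hermitian]

lemma conjSystem_A (G : PassiveQLS m n) : G.conjSystem.A = conjMat G.A := by
  ext i j
  simp [A, conjSystem, conjMat, Matrix.mul_apply, Complex.conj_ofNat]

lemma toQLS_S (G : PassiveQLS m n) : G.toQLS.S = 1 := by
  simp [toQLS, QLS.S, dbl, conjMat, Matrix.map_one]

lemma toQLS_C (G : PassiveQLS m n) :
    G.toQLS.C = fromBlocks G.C 0 0 G.conjSystem.C := by
  simp [toQLS, QLS.C, dbl, conjMat, conjSystem]

lemma flat_toQLS_C (G : PassiveQLS m n) :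
    flat G.toQLS.C = fromBlocks G.Cᴴ 0 0 G.conjSystem.Cᴴ := by
  simp [toQLS_C, flat, signJ, fromBlocks_conjTranspose, fromBlocks_multiply]

lemma toQLS_A (G : PassiveQLS m n) :
    G.toQLS.A = fromBlocks G.A 0 0 G.conjSystem.A := by
  have hΩ : signJ n * G.toQLS.Ω = fromBlocks G.Ω 0 0 G.conjSystem.Ω := by
    simp [toQLS, QLS.Ω, dbl, conjMat, conjSystem, signJ, fromBlocks_multiply]
  rw [QLS.A, hΩ, flat_toQLS_C, toQLS_C, fromBlocks_multiply, fromBlocks_smul, fromBlocks_smul,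
    fromBlocks_neg, fromBlocks_sub]
  simp only [A, Matrix.mul_zero, Matrix.zero_mul, add_zero, zero_add, smul_zero, neg_zero, sub_zero]
  congr 1 <;> abel

lemma toQLS_A_roots (G : PassiveQLS m n) :
    G.toQLS.A.charpoly.roots
      = G.A.charpoly.roots + G.A.charpoly.roots.map (starRingEnd ℂ) := by
  rw [toQLS_A, charpoly_fromBlocks_zero₁₂, conjSystem_A,
    roots_mul (mul_ne_zero (charpoly_monic _).ne_zero (charpoly_monic _).ne_zero),
    charpoly_conjMat_roots]

lemma isHurwitz_iff (G : PassiveQLS m n) :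
    G.toQLS.IsHurwitz ↔ ∀ z ∈ G.A.charpoly.roots, z.re < 0 := by
  simp only [QLS.IsHurwitz, mem_spectrum_iff_mem_roots, toQLS_A_roots, Multiset.mem_add,
    Multiset.mem_map]
  constructor
  · exact fun h z hz => h z (Or.inl hz)
  · rintro h z (hz | ⟨w, hw, rfl⟩)
    · exact h z hz
    · simpa using h w hw

/-- The transfer matrix from the annihilation part of the input to that of the output. -/
noncomputable def passiveTransfer (G : PassiveQLS m n) (s : ℂ) : Matrix (Fin m) (Fin m) ℂ :=
  1 - G.C * (s • (1 : Matrix (Fin n) (Fin n) ℂ) - G.A)⁻¹ * G.Cᴴ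

lemma toQLS_transfer (G : PassiveQLS m n) {s : ℂ} (hs : s ∉ spectrum ℂ G.toQLS.A) :
    G.toQLS.transfer s
      = fromBlocks (G.passiveTransfer s) 0 0 (G.conjSystem.passiveTransfer s) := by
  rw [mem_spectrum_iff_mem_roots, toQLS_A_roots, Multiset.mem_add, not_or,
    ← charpoly_conjMat_roots, ← conjSystem_A] at hs
  have hu : ∀ B : Matrix (Fin n) (Fin n) ℂ, s ∉ B.charpoly.roots →
      IsUnit (s • (1 : Matrix (Fin n) (Fin n) ℂ) - B) := by
    intro B hB
    rw [← mem_spectrum_iff_mem_roots, spectrum.notMem_iff, Algebra.algebraMap_eq_smul_one] at hB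
    exact hB
  have hinv : (s • (1 : Matrix (Fin n ⊕ Fin n) (Fin n ⊕ Fin n) ℂ) - G.toQLS.A)⁻¹
      = fromBlocks (s • (1 : Matrix (Fin n) (Fin n) ℂ) - G.A)⁻¹ 0 0
        (s • (1 : Matrix (Fin n) (Fin n) ℂ) - G.conjSystem.A)⁻¹ := by
    refine Matrix.inv_eq_right_inv ?_
    rw [toQLS_A, ← fromBlocks_one, fromBlocks_smul, fromBlocks_sub, fromBlocks_multiply]
    have h1 := Matrix.mul_nonsing_inv _ ((Matrix.isUnit_iff_isUnit_det _).1 (hu _ hs.1))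
    have h2 := Matrix.mul_nonsing_inv _ ((Matrix.isUnit_iff_isUnit_det _).1 (hu _ hs.2))
    simp [h1, h2]
  rw [QLS.transfer, hinv, toQLS_S, flat_toQLS_C, toQLS_C, passiveTransfer]
  rw [← fromBlocks_one, fromBlocks_multiply, fromBlocks_multiply, fromBlocks_sub, passiveTransfer]
  simp

/-- Since `A + A† = -C† C`, one has `(s - A) - C† C = s + A†`. The identity `det (1 - XY) = det (1 -
YX)` then gives the scalar transfer function as `det (s + A†) / det (s - A)`. -/
lemma passiveTransfer_eq (G : PassiveQLS 1 n) {s : ℂ} (hs : s ∉ G.A.charpoly.roots) :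
    G.passiveTransfer s = allPass G.A.charpoly.roots s • 1 := by
  set B := s • (1 : Matrix (Fin n) (Fin n) ℂ) - G.A with hB
  have hdet : B.det ≠ 0 := by
    rw [hB, det_smul_one_sub]
    refine Multiset.prod_ne_zero fun h => ?_
    obtain ⟨z, hz, h0⟩ := Multiset.mem_map.1 h
    exact hs (by rwa [sub_eq_zero.1 h0])
  have hu : IsUnit B.det := hdet.isUnit
  have h1 : (G.passiveTransfer s).det * B.det
      = (s • (1 : Matrix (Fin n) (Fin n) ℂ) - -G.Aᴴ).det := by
    have h2 : s • (1 : Matrix (Fin n) (Fin n) ℂ) - -G.Aᴴ = (1 - G.Cᴴ * (G.C * B⁻¹)) * B := by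
      rw [Matrix.sub_mul, Matrix.one_mul, Matrix.mul_assoc, Matrix.mul_assoc,
        Matrix.nonsing_inv_mul _ hu, Matrix.mul_one, hB]
      have := G.A_add_conjTranspose
      rw [← neg_eq_iff_eq_neg] at this
      rw [← this]
      abel
    rw [h2, det_mul, det_one_sub_mul_comm]
    rfl
  have h3 : (s • (1 : Matrix (Fin n) (Fin n) ℂ) - -G.Aᴴ).det
      = (G.A.charpoly.roots.map fun z => s + conj z).prod := by
    have : s • (1 : Matrix (Fin n) (Fin n) ℂ) - -G.Aᴴ
        = -((-s) • (1 : Matrix (Fin n) (Fin n) ℂ) - G.Aᴴ) := by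
      rw [neg_smul]; abel
    have hc : Multiset.card G.A.charpoly.roots = n := by
      rw [← (IsAlgClosed.splits G.A.charpoly).natDegree_eq_card_roots,
        charpoly_natDegree_eq_dim, Fintype.card_fin]
    have hp : (G.A.charpoly.roots.map fun z => -s - conj z).prod
        = (-1) ^ n * (G.A.charpoly.roots.map fun z => s + conj z).prod := by
      have hpow : (-1 : ℂ) ^ n = (-1) ^ Multiset.card G.A.charpoly.roots := by rw [hc]
      rw [hpow, ← Multiset.card_map (fun z => s + conj z), ← Multiset.prod_map_neg,
        Multiset.map_map]
      refine congrArg _ (Multiset.map_congr rfl fun z _ => ?_)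
      simp only [Function.comp_apply]
      ring
    rw [this, det_neg, det_smul_one_sub, charpoly_conjTranspose_roots, Multiset.map_map,
      Fintype.card_fin]
    simp only [Function.comp_apply]
    rw [hp, ← mul_assoc, ← mul_pow]
    simp
  rw [h3, det_smul_one_sub] at h1
  ext i j
  obtain rfl := Subsingleton.elim i 0
  obtain rfl := Subsingleton.elim j 0
  rw [det_fin_one] at h1
  rw [allPass, Multiset.prod_map_div, ← h1, ← det_smul_one_sub, mul_div_cancel_right₀ _ hdet]
  simp

/-- Both transfer matrices are diagonal. The all-pass property makes the diagonal factors 1; off the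
diagonal, conjugation turns the second factor into the same all-pass function at `-s`. -/
lemma powerSpectrum_eq (G : PassiveQLS 1 n) (N M : Matrix (Fin 1) (Fin 1) ℂ) {s : ℂ}
    (hs : G.toQLS.IsRegularAt s) :
    G.toQLS.powerSpectrum (inputCov N M) s =
      inputCov N M ⊙ fromBlocks (of fun _ _ => 1) (of fun _ _ => squeezing G.A.charpoly.roots s)
       (of fun _ _ => squeezing (G.A.charpoly.roots.map (starRingEnd ℂ)) s) (of fun _ _ => 1) := by
  obtain ⟨h1, h2⟩ := hs
  rw [QLS.powerSpectrum, toQLS_transfer G h1, toQLS_transfer G h2]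
  rw [mem_spectrum_iff_mem_roots, toQLS_A_roots, Multiset.mem_add, not_or,
    ← charpoly_conjMat_roots, ← conjSystem_A] at h1 h2
  rw [passiveTransfer_eq G h1.1, passiveTransfer_eq G h2.1, passiveTransfer_eq _ h1.2,
    passiveTransfer_eq _ h2.2]
  have e1 := allPass_mul_conj _ _ h1.1 h2.1
  have e2 := allPass_mul_conj _ _ h1.2 h2.2
  have e3 := allPass_mul_allPass_neg G.A.charpoly.roots s
  have e4 := allPass_mul_allPass_neg (G.A.charpoly.roots.map (starRingEnd ℂ)) s
  have e5 : conj (allPass (G.A.charpoly.roots.map (starRingEnd ℂ)) (-conj s))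
      = allPass G.A.charpoly.roots (-s) := by
    rw [conj_allPass, Multiset.map_map]
    simp
  have e6 : conj (allPass G.A.charpoly.roots (-conj s))
      = allPass (G.A.charpoly.roots.map (starRingEnd ℂ)) (-s) := by
    rw [conj_allPass]
    simp
  rw [conjSystem_A, charpoly_conjMat_roots] at e2 ⊢
  rw [← e3, ← e4, ← e5, ← e6, ← e1, inputCov, fromBlocks_conjTranspose, fromBlocks_multiply,
    fromBlocks_multiply]
  ext (i | i) (j | j) <;> obtain rfl := Subsingleton.elim i 0 <;>
    obtain rfl := Subsingleton.elim j 0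
  · simp; ring
  · simp; ring
  · simp; ring
  · simp only [fromBlocks_apply₂₂, hadamard_apply, of_apply, e1, mul_one]
    simp
    linear_combination N 0 0 * e2

end PassiveQLS

/-! ### Poles of the power spectrum bound the number of modes from below. -/

/-- The polynomial `s ↦ conj (p (-conj s))`. -/
noncomputable def starPoly (p : ℂ[X]) : ℂ[X] := (p.map (starRingEnd ℂ)).comp (-X)

lemma eval_starPoly (p : ℂ[X]) (s : ℂ) : (starPoly p).eval s = conj (p.eval (-conj s)) := by
  rw [starPoly, eval_comp, eval_neg, eval_X, ← Polynomial.eval_map_apply]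
  simp

lemma isCoprime_prod_X_sub_C {R : Multiset ℂ} {q : ℂ[X]} (h : ∀ z ∈ R, q.eval z ≠ 0) :
    IsCoprime (R.map fun z => X - Polynomial.C z).prod q := by
  induction R using Multiset.induction_on with
  | empty => simpa using isCoprime_one_left
  | cons z R ih =>
    rw [Multiset.map_cons, Multiset.prod_cons]
    refine IsCoprime.mul_left ?_ (ih fun w hw => h w (Multiset.mem_cons_of_mem hw))
    rw [(irreducible_X_sub_C z).coprime_iff_not_dvd, dvd_iff_isRoot]
    exact h z (Multiset.mem_cons_self z R)

namespace QLS

variable {m n : ℕ}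

lemma finite_not_isRegularAt (G : QLS m n) : {s | ¬ G.IsRegularAt s}.Finite := by
  have h1 : {s | s ∈ G.A.charpoly.roots}.Finite := Multiset.finite_toSet _
  have h2 : {s | -conj s ∈ G.A.charpoly.roots}.Finite := by
    refine h1.preimage (f := fun s : ℂ => -conj s) fun a _ b _ hab => ?_
    exact (starRingEnd ℂ).injective (neg_injective hab)
  refine (h1.union h2).subset fun s hs => ?_
  simp only [IsRegularAt, mem_spectrum_iff_mem_roots, Set.mem_ofPred_eq] at hs
  by_contra hc
  exact hs (by simpa [not_or] using hc)

lemma charpoly_eval_ne_zero (G : QLS m n) {s : ℂ} (hs : s ∉ spectrum ℂ G.A) :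
    G.A.charpoly.eval s ≠ 0 := fun h =>
  hs ((mem_spectrum_iff_mem_roots _ _).2 ((mem_roots G.A.charpoly_monic.ne_zero).2 h))

/-- The resolvent is the adjugate of `s - A` divided by the characteristic polynomial, so one factor
of the latter clears all denominators. -/
lemma exists_transfer_mul_charpoly (G : QLS m n) (i j : Fin m ⊕ Fin m) :
    ∃ a : ℂ[X], ∀ s, s ∉ spectrum ℂ G.A →
      G.transfer s i j * G.A.charpoly.eval s = a.eval s := by
  set W : Matrix (Fin m ⊕ Fin m) (Fin m ⊕ Fin m) ℂ[X] :=
    (G.A.charpoly • (1 : Matrix (Fin m ⊕ Fin m) (Fin m ⊕ Fin m) ℂ[X]) -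
      G.C.map Polynomial.C * adjugate (charmatrix G.A) * (flat G.C).map Polynomial.C) *
        G.S.map Polynomial.C with hW
  refine ⟨W i j, fun s hs => ?_⟩
  have hD := G.charpoly_eval_ne_zero hs
  have hm : (charmatrix G.A).map (evalRingHom s)
      = s • (1 : Matrix (Fin n ⊕ Fin n) (Fin n ⊕ Fin n) ℂ) - G.A := by
    ext a b
    by_cases hab : a = b
    · subst hab; simp [charmatrix]
    · simp [charmatrix, hab]
  have hdet : (s • (1 : Matrix (Fin n ⊕ Fin n) (Fin n ⊕ Fin n) ℂ) - G.A).det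
      = G.A.charpoly.eval s := by
    rw [det_smul_one_sub, charpoly_eval_eq_prod]
  have hCC : ∀ {α β : Type} (Y : Matrix α β ℂ), (Y.map Polynomial.C).map (evalRingHom s) = Y := by
    intro α β Y
    ext a b
    simp
  have h1 : W.map (evalRingHom s)
      = (G.A.charpoly.eval s • (1 : Matrix _ _ ℂ) -
        G.C * adjugate (s • (1 : Matrix (Fin n ⊕ Fin n) (Fin n ⊕ Fin n) ℂ) - G.A) * flat G.C)
        * G.S := by
    have hadj : (adjugate (charmatrix G.A)).map (evalRingHom s)
        = adjugate (s • (1 : Matrix (Fin n ⊕ Fin n) (Fin n ⊕ Fin n) ℂ) - G.A) := by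
      rw [← hm]
      exact RingHom.map_adjugate _ _
    rw [hW, Matrix.map_mul, Matrix.map_sub _ (map_sub _), Matrix.map_mul, Matrix.map_mul, hCC, hCC,
      hCC, hadj]
    congr 2
    ext a b
    by_cases hab : a = b
    · subst hab; simp
    · simp [hab]
  have h2 := congrFun (congrFun h1 i) j
  rw [Matrix.map_apply, coe_evalRingHom] at h2
  rw [h2, transfer, Matrix.inv_def, hdet, Ring.inverse_eq_inv', mul_comm, ← smul_eq_mul,
    ← Matrix.smul_apply, ← Matrix.smul_mul, smul_sub, Matrix.mul_smul, Matrix.smul_mul, smul_smul,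
    mul_inv_cancel₀ hD, one_smul]

lemma exists_powerSpectrum_mul (G : QLS m n) (V : Matrix (Fin m ⊕ Fin m) (Fin m ⊕ Fin m) ℂ)
    (i j : Fin m ⊕ Fin m) :
    ∃ b : ℂ[X], ∀ s, G.IsRegularAt s →
      G.powerSpectrum V s i j * (G.A.charpoly.eval s * (starPoly G.A.charpoly).eval s)
        = b.eval s := by
  choose a ha using G.exists_transfer_mul_charpoly
  refine ⟨∑ k, (∑ l, a i l * Polynomial.C (V l k)) * starPoly (a j k), fun s hs => ?_⟩
  simp only [eval_finsetSum, eval_mul, eval_C, eval_starPoly, ← ha _ _ _ hs.1,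
    ← ha _ _ _ hs.2, powerSpectrum, Matrix.mul_apply, conjTranspose_apply, map_mul, Finset.sum_mul]
  refine Finset.sum_congr rfl fun k _ => Finset.sum_congr rfl fun l _ => ?_
  rw [RCLike.star_def]
  ring

/-- Every left half-plane pole of a spectrum entry comes from the first transfer factor, because the
poles of the adjoint factor lie in the right half-plane. The finite set `F` allows for points where
the competing system is not regular. -/
lemma prod_X_sub_C_dvd_charpoly (G : QLS m n) (hG : G.IsHurwitz)
    (V : Matrix (Fin m ⊕ Fin m) (Fin m ⊕ Fin m) ℂ) (i j : Fin m ⊕ Fin m) {c : ℂ} (hc : c ≠ 0)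
    {R : Multiset ℂ} (hre : ∀ z ∈ R, z.re < 0) (hR : ∀ z ∈ R, conj z ∉ R)
    {F : Set ℂ} (hF : F.Finite)
    (h : ∀ s ∉ F, G.IsRegularAt s → G.powerSpectrum V s i j = c * squeezing R s) :
    (R.map fun z => X - Polynomial.C z).prod ∣ G.A.charpoly := by
  obtain ⟨b, hb⟩ := G.exists_powerSpectrum_mul V i j
  set p : ℂ[X] := (R.map fun z => X - Polynomial.C z).prod
  set p' : ℂ[X] := (R.map fun z => X + Polynomial.C z).prod
  set q : ℂ[X] := (R.map fun z => X ^ 2 - Polynomial.C (conj z ^ 2)).prod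
  have hpp : ∀ s, (p * p').eval s = (R.map fun z => s ^ 2 - z ^ 2).prod := by
    intro s
    rw [← Multiset.prod_map_mul, eval_multiset_prod, Multiset.map_map]
    refine congrArg _ (Multiset.map_congr rfl fun z _ => ?_)
    simp
    ring
  have hq : ∀ s, q.eval s = (R.map fun z => s ^ 2 - conj z ^ 2).prod := by
    intro s
    rw [eval_multiset_prod, Multiset.map_map]
    refine congrArg _ (Multiset.map_congr rfl fun z _ => ?_)
    simp
  have hfin : {s | s ∈ R ∨ -s ∈ R}.Finite := by
    have h1 : {s | s ∈ R}.Finite := Multiset.finite_toSet _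
    exact h1.union (h1.preimage (f := fun s : ℂ => -s) neg_injective.injOn)
  -- Both sides agree at all but finitely many points, hence as polynomials.
  have hpoly : b * (p * p') = (Polynomial.C c * q) * (G.A.charpoly * starPoly G.A.charpoly) := by
    refine eq_of_infinite_eval_eq _ _ ?_
    refine ((hF.union (G.finite_not_isRegularAt.union hfin)).infinite_compl).mono fun s hs => ?_
    simp only [Set.mem_compl_iff, Set.mem_union, Set.mem_ofPred_eq, not_or, not_not] at hs
    obtain ⟨h1, h2, h3, h4⟩ := hs
    have hne : (R.map fun z => s ^ 2 - z ^ 2).prod ≠ 0 := by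
      refine Multiset.prod_ne_zero fun h0 => ?_
      obtain ⟨z, hz, h0⟩ := Multiset.mem_map.1 h0
      rcases sq_eq_sq_iff_eq_or_eq_neg.1 (sub_eq_zero.1 h0) with h' | h'
      · exact h3 (h' ▸ hz)
      · exact h4 (by rwa [h', neg_neg])
    rw [Set.mem_ofPred_eq, eval_mul, hpp, eval_mul, eval_mul, eval_mul, hq, ← hb s h2, h s h1 h2,
      squeezing, Multiset.prod_map_div, eval_C]
    field_simp
  have hdvd : p ∣ (Polynomial.C c * q) * (G.A.charpoly * starPoly G.A.charpoly) :=
    ⟨b * p', by rw [← hpoly]; ring⟩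
  -- The zeros of `q` are `± conj w` with `w ∈ R`: `conj w` is excluded by `hR`, and `-conj w` lies
  -- in the right half-plane.
  have hcop : IsCoprime p (Polynomial.C c * q) := by
    refine isCoprime_prod_X_sub_C fun z hz => ?_
    rw [eval_mul, eval_C, hq]
    refine mul_ne_zero hc (Multiset.prod_ne_zero fun h0 => ?_)
    obtain ⟨w, hw, h0⟩ := Multiset.mem_map.1 h0
    rcases sq_eq_sq_iff_eq_or_eq_neg.1 (sub_eq_zero.1 h0) with h' | h'
    · exact hR w hw (h' ▸ hz)
    · have h5 := hre z hz
      have h6 := hre w hw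
      rw [h', Complex.neg_re, Complex.conj_re] at h5
      linarith
  have hcop' : IsCoprime p (starPoly G.A.charpoly) := by
    refine isCoprime_prod_X_sub_C fun z hz h0 => ?_
    rw [eval_starPoly, map_eq_zero] at h0
    refine G.charpoly_eval_ne_zero (fun hs => ?_) h0
    have h5 := hre z hz
    have h6 := hG _ hs
    rw [Complex.neg_re, Complex.conj_re] at h6
    linarith
  exact hcop'.dvd_of_dvd_mul_right (hcop.dvd_of_dvd_mul_left hdvd)

end QLS

/-- The two off-diagonal entries supply the coprime divisors with roots `R` and `conj R`; their
product has degree `2n` and divides a polynomial of degree `2n'`. -/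
lemma PassiveQLS.isGloballyMinimal_of_disjoint {n : ℕ} (G : PassiveQLS 1 n)
    (hG : G.toQLS.IsHurwitz) (N : Matrix (Fin 1) (Fin 1) ℂ) {M : Matrix (Fin 1) (Fin 1) ℂ}
    (hM : M ≠ 0) (hR : ∀ z ∈ G.A.charpoly.roots, conj z ∉ G.A.charpoly.roots) :
    G.toQLS.IsGloballyMinimal (inputCov N M) := by
  intro n' hn' G' hG' hsame
  rw [isHurwitz_iff] at hG
  have hM0 : M 0 0 ≠ 0 := fun h => hM (by
    ext i j
    rw [Subsingleton.elim i 0, Subsingleton.elim j 0, h, Matrix.zero_apply])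
  set R := G.A.charpoly.roots with hRdef
  have hmem : ∀ z, z ∈ R.map (starRingEnd ℂ) ↔ conj z ∈ R := by
    intro z
    rw [Multiset.mem_map]
    constructor
    · rintro ⟨w, hw, rfl⟩
      simpa using hw
    · exact fun h => ⟨_, h, by simp⟩
  have hF := G.toQLS.finite_not_isRegularAt
  have hps : ∀ s ∉ {s | ¬ G.toQLS.IsRegularAt s}, G'.IsRegularAt s →
      G'.powerSpectrum (inputCov N M) s = _ := fun s hs hs' =>
    (hsame s (not_not.1 hs) hs').symm.trans (G.powerSpectrum_eq N M (not_not.1 hs))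
  have h1 := G'.prod_X_sub_C_dvd_charpoly hG' (inputCov N M) (Sum.inl 0) (Sum.inr 0) hM0 hG hR hF
    fun s hs hs' => by rw [hps s hs hs']; simp [inputCov, hRdef]
  have h2 := G'.prod_X_sub_C_dvd_charpoly hG' (inputCov N M) (Sum.inr 0) (Sum.inl 0)
    (star_ne_zero.2 hM0) (R := R.map (starRingEnd ℂ))
    (fun z hz => by simpa using hG _ ((hmem z).1 hz))
    (fun z hz hz' => hR _ ((hmem z).1 hz) ((hmem _).1 hz')) hF
    fun s hs hs' => by rw [hps s hs hs']; simp [inputCov, hRdef]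
  have hcop : IsCoprime (R.map fun z => X - Polynomial.C z).prod
      ((R.map (starRingEnd ℂ)).map fun z => X - Polynomial.C z).prod := by
    refine isCoprime_prod_X_sub_C fun z hz h0 => ?_
    rw [eval_multiset_prod, Multiset.prod_eq_zero_iff, Multiset.map_map] at h0
    obtain ⟨w, hw, h0⟩ := Multiset.mem_map.1 h0
    rw [Function.comp_apply, eval_sub, eval_X, eval_C, sub_eq_zero] at h0
    exact hR z hz ((hmem z).1 (h0 ▸ hw))
  have hdeg := natDegree_le_of_dvd (hcop.mul_dvd h1 h2) G'.A.charpoly_monic.ne_zero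
  have hcard : Multiset.card R = n := by
    rw [hRdef, ← (IsAlgClosed.splits G.A.charpoly).natDegree_eq_card_roots,
      charpoly_natDegree_eq_dim, Fintype.card_fin]
  rw [Monic.natDegree_mul (monic_multiset_prod_of_monic _ _ fun z _ => monic_X_sub_C z)
    (monic_multiset_prod_of_monic _ _ fun z _ => monic_X_sub_C z),
    natDegree_multiset_prod_X_sub_C_eq_card, natDegree_multiset_prod_X_sub_C_eq_card,
    charpoly_natDegree_eq_dim, Multiset.card_map, hcard, Fintype.card_sum, Fintype.card_fin] at hdeg
  omega

/-! ### Cascades of one-mode systems. -/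

namespace PassiveQLS

variable {m : ℕ}

/-- The Hamiltonian coupling cancels one off-diagonal block of `½ C† C` and doubles the other:
influence passes only from the first system to the second. The triangular form makes spectra add,
which is why the order of a cascade is immaterial. -/
lemma series_A {n₁ n₂ : ℕ} (G₂ : PassiveQLS m n₂) (G₁ : PassiveQLS m n₁) :
    (series G₂ G₁).A
      = reindex finSumFinEquiv finSumFinEquiv (fromBlocks G₁.A 0 (-(G₂.Cᴴ * G₁.C)) G₂.A) := by
  have hC : (series G₂ G₁).Cᴴ * (series G₂ G₁).C
      = reindex finSumFinEquiv finSumFinEquiv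
        (fromBlocks (G₁.Cᴴ * G₁.C) (G₁.Cᴴ * G₂.C) (G₂.Cᴴ * G₁.C) (G₂.Cᴴ * G₂.C)) := by
    rw [series, ← fromRows_mul_fromCols]
    ext i j
    simp [Matrix.mul_apply, conjTranspose_apply]
    rcases finSumFinEquiv.symm i with i | i <;> rcases finSumFinEquiv.symm j with j | j <;> rfl
  rw [A, hC]
  ext i j
  simp only [series, reindex_apply, submatrix_apply, Matrix.sub_apply, Matrix.neg_apply,
    Matrix.smul_apply]
  have h2 : (1 / (2 * Complex.I)) * Complex.I = 1 / 2 := by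
    field_simp
  rcases finSumFinEquiv.symm i with i | i <;> rcases finSumFinEquiv.symm j with j | j <;>
    simp only [fromBlocks_apply₁₁, fromBlocks_apply₁₂, fromBlocks_apply₂₁, fromBlocks_apply₂₂, A,
      Matrix.sub_apply, Matrix.neg_apply, Matrix.smul_apply, smul_eq_mul, Matrix.zero_apply]
  · linear_combination (G₁.Cᴴ * G₂.C) i j * h2
  · linear_combination -(G₂.Cᴴ * G₁.C) i j * h2

lemma series_A_roots {n₁ n₂ : ℕ} (G₂ : PassiveQLS m n₂) (G₁ : PassiveQLS m n₁) :
    (series G₂ G₁).A.charpoly.roots = G₁.A.charpoly.roots + G₂.A.charpoly.roots := by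
  rw [series_A, charpoly_reindex, charpoly_fromBlocks_zero₁₂,
    roots_mul (mul_ne_zero (charpoly_monic _).ne_zero (charpoly_monic _).ne_zero)]

lemma oneMode_A_roots {z : ℂ} (hz : z.re < 0) : (oneMode z).A.charpoly.roots = {z} := by
  have hA : (oneMode z).A = of fun _ _ => z := by
    ext i j
    have h1 : ((Real.sqrt (2 * |z.re|) : ℝ) : ℂ) * (Real.sqrt (2 * |z.re|) : ℝ) = -(2 * z.re) := by
      rw [← Complex.ofReal_mul, Real.mul_self_sqrt (by positivity), abs_of_neg hz]
      push_cast
      ring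
    simp only [A, oneMode, Matrix.sub_apply, Matrix.neg_apply, Matrix.smul_apply, of_apply,
      Matrix.mul_apply, Finset.univ_unique, Finset.sum_singleton, conjTranspose_apply,
      RCLike.star_def, Complex.conj_ofReal, h1, smul_eq_mul]
    linear_combination Complex.re_add_im z
  rw [hA, charpoly, det_fin_one, charmatrix_apply_eq, of_apply, roots_X_sub_C]

lemma cascade_A_roots {l : List ℂ} (hl : ∀ z ∈ l, z.re < 0) :
    (cascade l).A.charpoly.roots = l := by
  induction l with
  | nil => simp [charpoly]
  | cons z l ih =>
    have h := series_A_roots (oneMode z) (cascade l)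
    rw [ih fun w hw => hl w (List.mem_cons_of_mem z hw),
      oneMode_A_roots (hl z List.mem_cons_self)] at h
    refine h.trans ?_
    rw [add_comm, Multiset.singleton_add, Multiset.cons_coe]

end PassiveQLS

/-! ### Removal of conjugate pairs. -/

lemma count_map_conj (R : Multiset ℂ) (z : ℂ) :
    (R.map (starRingEnd ℂ)).count z = R.count (conj z) := by
  conv_lhs => rw [← Complex.conj_conj z]
  exact Multiset.count_map_eq_count' _ _ (starRingEnd ℂ).injective _

/-- `R` is the sum of `R - conj R` and `R ∩ conj R`, and the latter is conjugation-invariant. -/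
lemma squeezing_sub_map_conj (R : Multiset ℂ) {s : ℂ} (h₁ : s ∉ R) (h₂ : -s ∉ R) :
    squeezing (R - R.map (starRingEnd ℂ)) s = squeezing R s := by
  have hK : (R ∩ R.map (starRingEnd ℂ)).map (starRingEnd ℂ) = R ∩ R.map (starRingEnd ℂ) := by
    ext z
    simp only [count_map_conj, Multiset.count_inter, Complex.conj_conj]
    exact min_comm _ _
  conv_rhs => rw [← Multiset.sub_add_inter R (R.map (starRingEnd ℂ)), squeezing_add,
    squeezing_eq_one hK (fun h => h₁ (Multiset.mem_inter.1 h).1)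
      (fun h => h₂ (Multiset.mem_inter.1 h).1), mul_one]

lemma conj_notMem_sub_map_conj (R : Multiset ℂ) {z : ℂ} (hz : z ∈ R - R.map (starRingEnd ℂ)) :
    conj z ∉ R - R.map (starRingEnd ℂ) := by
  intro h
  rw [← Multiset.count_pos, Multiset.count_sub, count_map_conj] at hz h
  rw [Complex.conj_conj] at h
  omega

section Cascade

variable {n : ℕ} {G : PassiveQLS 1 n} {l : List ℂ}

lemma cascade_unpairedEigenvalues_roots (hG : G.toQLS.IsHurwitz)
    (hl : (l : Multiset ℂ) = unpairedEigenvalues G.A) :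
    (PassiveQLS.cascade l).A.charpoly.roots = unpairedEigenvalues G.A := by
  rw [← hl]
  refine PassiveQLS.cascade_A_roots fun z hz => (G.isHurwitz_iff.1 hG) z ?_
  rw [← Multiset.mem_coe, hl, unpairedEigenvalues] at hz
  exact Multiset.mem_of_le tsub_le_self hz

lemma cascade_unpairedEigenvalues_isHurwitz (hG : G.toQLS.IsHurwitz)
    (hl : (l : Multiset ℂ) = unpairedEigenvalues G.A) :
    (PassiveQLS.cascade l).toQLS.IsHurwitz := by
  rw [PassiveQLS.isHurwitz_iff, cascade_unpairedEigenvalues_roots hG hl]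
  exact fun z hz => (G.isHurwitz_iff.1 hG) z (Multiset.mem_of_le tsub_le_self hz)

lemma cascade_unpairedEigenvalues_samePowerSpectrum (hG : G.toQLS.IsHurwitz)
    (hl : (l : Multiset ℂ) = unpairedEigenvalues G.A) (N M : Matrix (Fin 1) (Fin 1) ℂ) :
    QLS.SamePowerSpectrum (inputCov N M) G.toQLS (PassiveQLS.cascade l).toQLS := by
  intro s h h'
  rw [PassiveQLS.powerSpectrum_eq _ _ _ h, PassiveQLS.powerSpectrum_eq _ _ _ h',
    cascade_unpairedEigenvalues_roots hG hl]
  simp only [QLS.IsRegularAt, mem_spectrum_iff_mem_roots, PassiveQLS.toQLS_A_roots,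
    Multiset.mem_add, not_or] at h
  obtain ⟨⟨h1, h2⟩, h3, h4⟩ := h
  have hc : ∀ w, w ∉ G.A.charpoly.roots.map (starRingEnd ℂ) → conj w ∉ G.A.charpoly.roots :=
    fun w hw hw' => hw (Multiset.mem_map.2 ⟨_, hw', by simp⟩)
  have h5 : -s ∉ G.A.charpoly.roots := by simpa using hc _ h4
  have h6 : -s ∉ G.A.charpoly.roots.map (starRingEnd ℂ) := by
    intro hw
    obtain ⟨w, hw, hws⟩ := Multiset.mem_map.1 hw
    refine h3 ?_
    have : -conj s = w := by rw [← map_neg, ← hws, Complex.conj_conj]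
    rwa [this]
  have e1 := squeezing_sub_map_conj _ h1 h5
  have e2 := squeezing_sub_map_conj _ h2 h6
  have e3 : (unpairedEigenvalues G.A).map (starRingEnd ℂ)
      = G.A.charpoly.roots.map (starRingEnd ℂ)
        - (G.A.charpoly.roots.map (starRingEnd ℂ)).map (starRingEnd ℂ) := by
    ext z
    simp only [unpairedEigenvalues, count_map_conj, Multiset.count_sub]
  rw [e3, e2, unpairedEigenvalues, e1]

lemma cascade_unpairedEigenvalues_isGloballyMinimal (hG : G.toQLS.IsHurwitz)
    (hl : (l : Multiset ℂ) = unpairedEigenvalues G.A) (N : Matrix (Fin 1) (Fin 1) ℂ)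
    {M : Matrix (Fin 1) (Fin 1) ℂ} (hM : M ≠ 0) :
    (PassiveQLS.cascade l).toQLS.IsGloballyMinimal (inputCov N M) := by
  refine PassiveQLS.isGloballyMinimal_of_disjoint _ (cascade_unpairedEigenvalues_isHurwitz hG hl) N
    hM ?_
  rw [cascade_unpairedEigenvalues_roots hG hl]
  exact fun z hz => conj_notMem_sub_map_conj _ hz

/-- A conjugate pair or a real eigenvalue makes `R ∩ conj R` non-empty, so the cascade is a strictly
smaller competitor. -/
lemma disjoint_of_isGloballyMinimal (hG : G.toQLS.IsHurwitz) {N M : Matrix (Fin 1) (Fin 1) ℂ}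
    (hmin : G.toQLS.IsGloballyMinimal (inputCov N M)) :
    ∀ z ∈ G.A.charpoly.roots, conj z ∉ G.A.charpoly.roots := by
  intro z hz hz'
  have hl := Multiset.coe_toList (unpairedEigenvalues G.A)
  refine hmin _ ?_ _ (cascade_unpairedEigenvalues_isHurwitz hG hl)
    (cascade_unpairedEigenvalues_samePowerSpectrum hG hl N M)
  have hcard : Multiset.card G.A.charpoly.roots = n := by
    rw [← (IsAlgClosed.splits G.A.charpoly).natDegree_eq_card_roots,
      charpoly_natDegree_eq_dim, Fintype.card_fin]
  have hpos : 0 < Multiset.card (G.A.charpoly.roots ∩ G.A.charpoly.roots.map (starRingEnd ℂ)) :=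
    Multiset.card_pos_iff_exists_mem.2
      ⟨z, Multiset.mem_inter.2 ⟨hz, Multiset.mem_map.2 ⟨_, hz', by simp⟩⟩⟩
  have hsum := congrArg Multiset.card
    (Multiset.sub_add_inter G.A.charpoly.roots (G.A.charpoly.roots.map (starRingEnd ℂ)))
  rw [Multiset.card_add, hcard] at hsum
  rw [Multiset.length_toList, unpairedEigenvalues]
  omega

end Cascade

/-! ### Sylvester and Lyapunov equations. -/

section Linear

variable {ι : Type*} [Fintype ι]

lemma exists_dotProduct_star_self (w : ι → ℂ) :
    ∃ r : ℝ, 0 ≤ r ∧ star w ⬝ᵥ w = r ∧ (r = 0 → w = 0) := by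
  refine ⟨∑ i, ‖w i‖ ^ 2, by positivity, ?_, fun h => ?_⟩
  · simp only [dotProduct, Pi.star_apply, RCLike.star_def, Complex.conj_mul']
    push_cast
    rfl
  · rw [Finset.sum_eq_zero_iff_of_nonneg fun i _ => by positivity] at h
    ext i
    simpa using h i (Finset.mem_univ i)

variable [DecidableEq ι]

lemma mem_spectrum_iff_exists_mulVec {A : Matrix ι ι ℂ} {z : ℂ} :
    z ∈ spectrum ℂ A ↔ ∃ v ≠ 0, A *ᵥ v = z • v := by
  rw [mem_spectrum_iff_mem_roots, mem_roots A.charpoly_monic.ne_zero, IsRoot, eval_charpoly,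
    ← exists_mulVec_eq_zero_iff]
  refine exists_congr fun v => and_congr_right fun _ => ?_
  rw [Matrix.sub_mulVec, Matrix.scalar_apply, ← Matrix.smul_one_eq_diagonal, Matrix.smul_mulVec,
    Matrix.one_mulVec, sub_eq_zero, eq_comm]

lemma mem_spectrum_conjTranspose {A : Matrix ι ι ℂ} {z : ℂ} :
    z ∈ spectrum ℂ Aᴴ ↔ conj z ∈ spectrum ℂ A := by
  rw [← Matrix.star_eq_conjTranspose, spectrum.map_star, Set.mem_star]
  rfl

lemma mem_spectrum_transpose {A : Matrix ι ι ℂ} {z : ℂ} :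
    z ∈ spectrum ℂ Aᵀ ↔ z ∈ spectrum ℂ A := by
  rw [mem_spectrum_iff_mem_roots, mem_spectrum_iff_mem_roots, charpoly_transpose]

/-- Uniqueness of the solution of a Sylvester equation with stable coefficients. -/
lemma eq_zero_of_mul_add_mul_eq_zero {A B X : Matrix ι ι ℂ} (hA : ∀ z ∈ spectrum ℂ A, z.re < 0)
    (hB : ∀ z ∈ spectrum ℂ B, z.re < 0) (h : A * X + X * B = 0) : X = 0 := by
  cases isEmpty_or_nonempty ι
  · exact Subsingleton.elim _ _
  have hX : A * X = X * -B := by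
    rw [Matrix.mul_neg]
    exact eq_neg_of_add_eq_zero_left h
  -- The relation `A X = X (-B)` passes to polynomials. For the characteristic polynomial of `A` the
  -- left side vanishes, while its value at `-B` is invertible because `A` and `-B` have disjoint
  -- spectra.
  have hp : ∀ p : ℂ[X], aeval A p * X = X * aeval (-B) p := by
    intro p
    induction p using Polynomial.induction_on with
    | C a => simp [Algebra.algebraMap_eq_smul_one]
    | add p q hp hq => rw [map_add, map_add, add_mul, mul_add, hp, hq]
    | monomial n a ih =>
      rw [pow_succ, ← mul_assoc, map_mul (aeval A) (Polynomial.C a * Polynomial.X ^ n),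
        map_mul (aeval (-B)) (Polynomial.C a * Polynomial.X ^ n), aeval_X, aeval_X, mul_assoc, hX,
        ← mul_assoc, ih, mul_assoc]
  have h0 := hp A.charpoly
  rw [aeval_self_charpoly, zero_mul] at h0
  have hu : IsUnit (aeval (-B) A.charpoly) := by
    by_contra hu
    rw [← spectrum.zero_mem_iff ℂ, spectrum.map_polynomial_aeval_of_nonempty _ _
      (spectrum.nonempty_of_isAlgClosed_of_finiteDimensional ℂ _)] at hu
    obtain ⟨w, hw, hw0⟩ := hu
    have h1 := hA w (by
      rw [mem_spectrum_iff_mem_roots, mem_roots A.charpoly_monic.ne_zero]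
      exact hw0)
    have h2 := hB (-w) (by rwa [← Set.mem_neg, spectrum.neg_eq])
    rw [Complex.neg_re] at h2
    linarith
  exact (hu.mul_left_eq_zero).1 h0.symm

lemma exists_mul_add_mul_eq {A B : Matrix ι ι ℂ} (hA : ∀ z ∈ spectrum ℂ A, z.re < 0)
    (hB : ∀ z ∈ spectrum ℂ B, z.re < 0) (K : Matrix ι ι ℂ) : ∃ X, A * X + X * B = K := by
  let L : Matrix ι ι ℂ →ₗ[ℂ] Matrix ι ι ℂ := LinearMap.mulLeft ℂ A + LinearMap.mulRight ℂ B
  have hinj : Function.Injective L := by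
    rw [injective_iff_map_eq_zero]
    exact fun X hX => eq_zero_of_mul_add_mul_eq_zero hA hB hX
  exact LinearMap.injective_iff_surjective.1 hinj K

lemma exists_mulVec_eq_smul_of_invariant {A : Matrix ι ι ℂ} {W : Submodule ℂ (ι → ℂ)} (hW : W ≠ ⊥)
    (h : ∀ x ∈ W, A *ᵥ x ∈ W) : ∃ (μ : ℂ) (x : ι → ℂ), x ∈ W ∧ x ≠ 0 ∧ A *ᵥ x = μ • x := by
  have : Nontrivial W := Submodule.nontrivial_iff_ne_bot.2 hW
  obtain ⟨μ, hμ⟩ := Module.End.exists_eigenvalue ((toLin' A).restrict h)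
  obtain ⟨x, hx⟩ := hμ.exists_hasEigenvector
  refine ⟨μ, x, x.2, fun h0 => hx.2 (Subtype.ext h0), ?_⟩
  exact congrArg Subtype.val hx.apply_eq_smul

/-- A solution of a Lyapunov equation with dissipative stable coefficients is positive
semidefinite, and its kernel, if non-zero, contains an eigenvector of `Aᴴ`. -/
lemma exists_eigenvector_of_lyapunov {κ : Type*} [Fintype κ] {A Q : Matrix ι ι ℂ}
    {C : Matrix κ ι ℂ} {b : Matrix ι κ ℂ} (hA : ∀ z ∈ spectrum ℂ A, z.re < 0)
    (hC : A + Aᴴ = -(Cᴴ * C)) (hQ : A * Q + Q * Aᴴ = -(b * bᴴ)) (hQh : Qᴴ = Q) {q : ℝ}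
    (hq : q ≤ 0) {v : ι → ℂ} (hv : v ≠ 0) (hQv : Q *ᵥ v = (q : ℂ) • v) :
    ∃ (μ : ℂ) (x : ι → ℂ), x ≠ 0 ∧ Q *ᵥ x = 0 ∧ bᴴ *ᵥ x = 0 ∧ Aᴴ *ᵥ x = μ • x := by
  have hgram : ∀ {κ' : Type _} [Fintype κ'] (D : Matrix κ' ι ℂ) (x : ι → ℂ),
      star x ⬝ᵥ ((Dᴴ * D) *ᵥ x) = star (D *ᵥ x) ⬝ᵥ (D *ᵥ x) := by
    intro κ' _ D x
    rw [← Matrix.mulVec_mulVec, Matrix.dotProduct_mulVec, Matrix.star_mulVec]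
  -- Evaluating the Lyapunov equation as a quadratic form at `x` gives `‖b† x‖² = q ‖C x‖²`. As `q ≤
  -- 0`, both sides vanish.
  have key : ∀ x, Q *ᵥ x = (q : ℂ) • x → bᴴ *ᵥ x = 0 ∧ (q = 0 ∨ C *ᵥ x = 0) := by
    intro x hx
    obtain ⟨r, hr, hre, hr0⟩ := exists_dotProduct_star_self (bᴴ *ᵥ x)
    obtain ⟨t, ht, hte, ht0⟩ := exists_dotProduct_star_self (C *ᵥ x)
    have h1 : star x ⬝ᵥ ((A * Q + Q * Aᴴ) *ᵥ x) = q * (star x ⬝ᵥ ((A + Aᴴ) *ᵥ x)) := by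
      have h2 : star x ᵥ* Q = (q : ℂ) • star x := by
        have := congrArg star hx
        rwa [Matrix.star_mulVec, hQh, star_smul, RCLike.star_def, Complex.conj_ofReal] at this
      rw [Matrix.add_mulVec, Matrix.add_mulVec, ← Matrix.mulVec_mulVec, ← Matrix.mulVec_mulVec, hx,
        dotProduct_add, dotProduct_add, Matrix.dotProduct_mulVec _ Q, h2, Matrix.mulVec_smul,
        dotProduct_smul, smul_dotProduct, smul_eq_mul, smul_eq_mul, mul_add]
    have h3 := hgram bᴴ x
    rw [conjTranspose_conjTranspose] at h3
    rw [hQ, hC, Matrix.neg_mulVec, Matrix.neg_mulVec, dotProduct_neg, dotProduct_neg, hgram, h3,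
      hre, hte] at h1
    have h4 : r = q * t := by
      have : (r : ℂ) = ((q * t : ℝ) : ℂ) := by
        push_cast
        linear_combination -h1
      exact_mod_cast this
    have h5 : q * t ≤ 0 := mul_nonpos_of_nonpos_of_nonneg hq ht
    have h6 : r = 0 := le_antisymm (h4 ▸ h5) hr
    refine ⟨hr0 h6, ?_⟩
    rw [h6, eq_comm, mul_eq_zero] at h4
    exact h4.imp_right ht0
  let W : Submodule ℂ (ι → ℂ) := Module.End.eigenspace (toLin' Q) (q : ℂ)
  have hWmem : ∀ x, x ∈ W ↔ Q *ᵥ x = (q : ℂ) • x := fun x => Module.End.mem_eigenspace_iff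
  have hadj : ∀ x, C *ᵥ x = 0 → A *ᵥ x = -(Aᴴ *ᵥ x) := by
    intro x hx
    have := congrArg (· *ᵥ x) hC
    simp only [Matrix.add_mulVec, Matrix.neg_mulVec, ← Matrix.mulVec_mulVec, hx, Matrix.mulVec_zero,
      neg_zero] at this
    exact eq_neg_of_add_eq_zero_left this
  -- The eigenspace of `Q` is invariant under `A†`: for `q = 0` directly from the Lyapunov equation,
  -- otherwise because `C x = 0` gives `A x = -A† x`.
  obtain ⟨μ, x, hxW, hx0, hx⟩ := exists_mulVec_eq_smul_of_invariant (A := Aᴴ) (W := W)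
    (Submodule.ne_bot_iff _ |>.2 ⟨v, (hWmem v).2 hQv, hv⟩) (by
      intro x hx
      rw [hWmem] at hx ⊢
      obtain ⟨h1, h2⟩ := key x hx
      have h3 := congrArg (· *ᵥ x) hQ
      simp only [Matrix.add_mulVec, Matrix.neg_mulVec, ← Matrix.mulVec_mulVec, h1, hx,
        Matrix.mulVec_smul, Matrix.mulVec_zero, neg_zero] at h3
      rcases h2 with h2 | h2
      · simpa [h2] using h3
      · rw [hadj x h2, smul_neg] at h3
        exact (neg_add_eq_zero.1 h3).symm)
  rw [hWmem] at hxW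
  obtain ⟨h1, h2⟩ := key x hxW
  -- If `C x = 0`, then `-μ` and `conj μ` are both eigenvalues of `A`, and their real parts are
  -- opposite.
  have hq0 : q = 0 := by
    refine h2.resolve_right fun h2 => ?_
    have h3 : -μ ∈ spectrum ℂ A :=
      mem_spectrum_iff_exists_mulVec.2 ⟨x, hx0, by rw [hadj x h2, hx, neg_smul]⟩
    have h4 : μ ∈ spectrum ℂ Aᴴ := mem_spectrum_iff_exists_mulVec.2 ⟨x, hx0, hx⟩
    have h5 := hA _ h3
    have h6 := hA _ (mem_spectrum_conjTranspose.1 h4)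
    rw [Complex.neg_re] at h5
    rw [Complex.conj_re] at h6
    linarith
  exact ⟨μ, x, hx0, by rw [hxW, hq0]; simp, h1, hx⟩

end Linear

/-! ### Takagi factorisation. -/

section Takagi

/-- An antilinear analogue of the spectral theorem: a real eigenvector is split off and its
orthogonal complement is invariant by symmetry. -/
lemma exists_orthonormal_of_antilinear (n : ℕ) : ∀ {E : Type} [NormedAddCommGroup E]
    [InnerProductSpace ℂ E] [FiniteDimensional ℂ E], Module.finrank ℂ E = n →
    ∀ f : E →ₛₗ[starRingEnd ℂ] E, (∀ x y, inner ℂ x (f y) = inner ℂ y (f x)) →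
    ∃ (b : Fin n → E) (d : Fin n → ℝ), Orthonormal ℂ b ∧ ∀ i, f (b i) = (d i : ℂ) • b i := by
  induction n with
  | zero => exact fun _ _ _ => ⟨Fin.elim0, Fin.elim0, ⟨fun i => i.elim0, fun i => i.elim0⟩,
      fun i => i.elim0⟩
  | succ n ih =>
    intro E _ _ _ hE f hf
    have : Nontrivial E := Module.nontrivial_of_finrank_pos (R := ℂ) (by omega)
    obtain ⟨μ, hμ⟩ := Module.End.exists_eigenvalue (K := ℂ) (V := E) (f.comp f)
    obtain ⟨v, hv⟩ := hμ.exists_hasEigenvector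
    have hv2 : f (f v) = μ • v := hv.apply_eq_smul
    have hvv : inner ℂ v v ≠ 0 := inner_self_ne_zero.2 hv.2
    have hμv : μ * inner ℂ v v = inner ℂ (f v) (f v) := by
      rw [hf (f v) v, hv2, inner_smul_right]
    have hμr : μ = ((‖f v‖ / ‖v‖) ^ 2 : ℝ) := by
      rw [inner_self_eq_norm_sq_to_K, inner_self_eq_norm_sq_to_K] at hμv
      have : (‖v‖ : ℂ) ≠ 0 := by simpa using hv.2
      push_cast
      rw [div_pow, eq_div_iff (pow_ne_zero 2 this)]
      exact hμv
    obtain ⟨d, w, hw, hfw⟩ : ∃ (d : ℝ) (w : E), ‖w‖ = 1 ∧ f w = (d : ℂ) • w := by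
      obtain ⟨d, w, hw, hfw⟩ : ∃ (d : ℝ) (w : E), w ≠ 0 ∧ f w = (d : ℂ) • w := by
        -- The linear map `f²` has eigenvalue `e²` at `v`, so `f v + e v` is an eigenvector of `f`
        -- for `e`, unless it vanishes and `f v = -e v`.
        set e : ℝ := ‖f v‖ / ‖v‖
        by_cases h0 : f v + (e : ℂ) • v = 0
        · refine ⟨-e, v, hv.2, ?_⟩
          rw [eq_neg_of_add_eq_zero_left h0, Complex.ofReal_neg, neg_smul]
        · refine ⟨e, _, h0, ?_⟩
          rw [map_add, map_smulₛₗ, hv2, hμr, Complex.conj_ofReal, smul_add, smul_smul, add_comm]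
          push_cast
          rw [sq]
      refine ⟨d, ((‖w‖⁻¹ : ℝ) : ℂ) • w, ?_, ?_⟩
      · rw [norm_smul, Complex.norm_real, norm_inv, norm_norm,
          inv_mul_cancel₀ (norm_ne_zero_iff.2 hw)]
      · rw [map_smulₛₗ, hfw, Complex.conj_ofReal, smul_comm]
    have hw0 : w ≠ 0 := by
      rintro rfl
      simp at hw
    let K : Submodule ℂ E := (ℂ ∙ w)ᗮ
    have hKmem : ∀ x, x ∈ K ↔ inner ℂ w x = 0 := fun x =>
      Submodule.mem_orthogonal_singleton_iff_inner_right
    have hfK : ∀ x ∈ K, f x ∈ K := by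
      intro x hx
      rw [hKmem] at hx ⊢
      rw [hf, hfw, inner_smul_right, inner_eq_zero_symm.1 hx, mul_zero]
    have hKdim : Module.finrank ℂ K = n := by
      have : Fact (Module.finrank ℂ E = n + 1) := ⟨hE⟩
      exact Submodule.finrank_orthogonal_span_singleton hw0
    let fK : K →ₛₗ[starRingEnd ℂ] K :=
      { toFun := fun x => ⟨f x, hfK x x.2⟩
        map_add' := fun x y => Subtype.ext (map_add f (x : E) y)
        map_smul' := fun c x => Subtype.ext (map_smulₛₗ f c (x : E)) }
    obtain ⟨b, d', hb, hbd⟩ := ih hKdim fK fun x y => hf x y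
    refine ⟨Fin.cons w fun i => (b i : E), Fin.cons d d', ?_, ?_⟩
    · have hb' := hb.comp_linearIsometry K.subtypeₗᵢ
      constructor
      · intro i
        refine Fin.cases hw (fun i => ?_) i
        exact hb'.1 i
      · intro i j
        refine Fin.cases ?_ (fun i => ?_) i <;> refine Fin.cases ?_ (fun j => ?_) j
        · exact fun h => absurd rfl h
        · exact fun _ => (hKmem _).1 (b j).2
        · exact fun _ => inner_eq_zero_symm.1 ((hKmem _).1 (b i).2)
        · exact fun h => hb'.2 fun h' => h (congrArg Fin.succ h')
    · intro i
      refine Fin.cases hfw (fun i => ?_) i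
      exact congrArg Subtype.val (hbd i)

/-- Takagi factorisation of a complex symmetric matrix. -/
lemma exists_takagi {n : ℕ} {Y : Matrix (Fin n) (Fin n) ℂ} (hY : Yᵀ = Y) :
    ∃ (U : Matrix (Fin n) (Fin n) ℂ) (d : Fin n → ℝ), Uᴴ * U = 1 ∧
      Y * conjMat U = U * diagonal fun i => (d i : ℂ) := by
  -- The columns of `U` are eigenvectors of the antilinear map `x ↦ Y x^#`, which is symmetric
  -- because `Y` is.
  let f : EuclideanSpace ℂ (Fin n) →ₛₗ[starRingEnd ℂ] EuclideanSpace ℂ (Fin n) :=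
    { toFun := fun x => WithLp.toLp 2 (Y *ᵥ star x.ofLp)
      map_add' := fun x y => by
        rw [WithLp.ofLp_add, star_add, Matrix.mulVec_add, WithLp.toLp_add]
      map_smul' := fun c x => by
        rw [WithLp.ofLp_smul, star_smul, Matrix.mulVec_smul, WithLp.toLp_smul]
        rfl }
  have hf : ∀ x y, inner ℂ x (f y) = inner ℂ y (f x) := by
    intro x y
    change (Y *ᵥ star y.ofLp) ⬝ᵥ star x.ofLp = (Y *ᵥ star x.ofLp) ⬝ᵥ star y.ofLp
    rw [dotProduct_comm, Matrix.dotProduct_mulVec, ← Matrix.mulVec_transpose, hY]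
  obtain ⟨b, d, hb, hbd⟩ := exists_orthonormal_of_antilinear n (by simp) f hf
  refine ⟨of fun i j => b j i, d, ?_, ?_⟩
  · ext i j
    have h := orthonormal_iff_ite.1 hb i j
    rw [PiLp.inner_apply] at h
    rw [Matrix.mul_apply, Matrix.one_apply, ← h]
    refine Finset.sum_congr rfl fun k _ => ?_
    simp [mul_comm]
  · ext i j
    rw [Matrix.mul_diagonal]
    have h : f (b j) i = ((d j : ℂ) • b j) i := by rw [hbd j]
    rw [mul_comm]
    exact h

end Takagi

/-! ### Symplectic matrices and one-mode normal forms. -/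

section Symplectic

variable {k : ℕ}

lemma signJ_mul_signJ (k : ℕ) : signJ k * signJ k = 1 := by
  simp [signJ, fromBlocks_multiply]

lemma flat_mul {l r : ℕ} (X : Matrix (Fin k ⊕ Fin k) (Fin l ⊕ Fin l) ℂ)
    (Y : Matrix (Fin l ⊕ Fin l) (Fin r ⊕ Fin r) ℂ) : flat (X * Y) = flat Y * flat X := by
  simp only [flat, conjTranspose_mul, Matrix.mul_assoc]
  rw [← Matrix.mul_assoc (signJ l) (signJ l), signJ_mul_signJ, Matrix.one_mul]

lemma dbl_mul (A B A' B' : Matrix (Fin k) (Fin k) ℂ) :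
    dbl A B * dbl A' B' = dbl (A * A' + B * conjMat B') (A * B' + B * conjMat A') := by
  have hadd : ∀ X Y : Matrix (Fin k) (Fin k) ℂ, conjMat (X + Y) = conjMat X + conjMat Y :=
    fun X Y => Matrix.map_add _ (map_add _) X Y
  have hconj : ∀ X : Matrix (Fin k) (Fin k) ℂ, conjMat (conjMat X) = X := by
    intro X
    ext i j
    simp [conjMat]
  simp only [dbl, fromBlocks_multiply, hadd, conjMat_mul, hconj]
  congr 1 <;> rw [add_comm]

lemma IsSymplectic.mul {T T' : Matrix (Fin k ⊕ Fin k) (Fin k ⊕ Fin k) ℂ} (hT : IsSymplectic T)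
    (hT' : IsSymplectic T') : IsSymplectic (T * T') := by
  obtain ⟨⟨A, B, rfl⟩, h1, h2⟩ := hT
  obtain ⟨⟨A', B', rfl⟩, h3, h4⟩ := hT'
  refine ⟨⟨_, _, dbl_mul A B A' B'⟩, ?_, ?_⟩
  · rw [flat_mul, Matrix.mul_assoc, ← Matrix.mul_assoc _ (dbl A B), h1, Matrix.one_mul, h3]
  · rw [flat_mul, Matrix.mul_assoc, ← Matrix.mul_assoc (dbl A' B'), h4, Matrix.one_mul, h2]

lemma isSymplectic_dbl_conjTranspose {U : Matrix (Fin k) (Fin k) ℂ} (hU : Uᴴ * U = 1) :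
    IsSymplectic (dbl Uᴴ 0) := by
  have h : flat (dbl Uᴴ 0) * dbl Uᴴ 0 = 1 := by
    have h2 : U * Uᴴ = 1 := mul_eq_one_comm.1 hU
    have h3 : conjMat U * conjMat Uᴴ = 1 := by
      rw [← conjMat_mul, h2]
      simp [conjMat, Matrix.map_one]
    have h4 : (conjMat Uᴴ)ᴴ = conjMat U := by
      rw [conjMat_conjTranspose, conjTranspose_eq_transpose_conjMat, transpose_transpose]
    simp [flat, dbl, signJ, fromBlocks_conjTranspose, fromBlocks_multiply, h2, h3, h4,
      show conjMat (0 : Matrix (Fin k) (Fin k) ℂ) = 0 from Matrix.map_zero _ (map_zero _)]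
  exact ⟨⟨_, _, rfl⟩, h, mul_eq_one_comm.1 h⟩

lemma isSymplectic_dbl_diagonal {α : Fin k → ℝ} {β : Fin k → ℂ}
    (h : ∀ i, (α i : ℂ) * α i - β i * conj (β i) = 1) :
    IsSymplectic (dbl (diagonal fun i => (α i : ℂ)) (diagonal β)) := by
  have hα : conjMat (diagonal fun i => (α i : ℂ)) = diagonal fun i => (α i : ℂ) := by
    rw [conjMat, diagonal_map (map_zero _)]
    simp
  have hβ : conjMat (diagonal β) = diagonal fun i => conj (β i) := diagonal_map (map_zero _)
  have h1 : flat (dbl (diagonal fun i => (α i : ℂ)) (diagonal β))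
      * dbl (diagonal fun i => (α i : ℂ)) (diagonal β) = 1 := by
    rw [← fromBlocks_one, ← diagonal_one]
    simp only [flat, dbl, hα, hβ, signJ, fromBlocks_conjTranspose, diagonal_conjTranspose,
      fromBlocks_multiply, Matrix.one_mul, Matrix.mul_one, Matrix.zero_mul, Matrix.mul_zero,
      Matrix.neg_mul, Matrix.mul_neg, add_zero, zero_add, neg_neg, diagonal_mul_diagonal,
      diagonal_add, diagonal_neg]
    rw [fromBlocks_inj]
    refine ⟨?_, ?_, ?_, ?_⟩ <;> try rw [← diagonal_zero]
    all_goals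
      congr 1
      ext i
      simp only [Pi.star_apply, RCLike.star_def, Complex.conj_ofReal, Complex.conj_conj]
    · linear_combination h i
    · ring
    · ring
    · linear_combination h i
  exact ⟨⟨_, _, rfl⟩, h1, mul_eq_one_comm.1 h1⟩

/-- Diagonalisation of the covariance `[r + 1, g; conj g, r]` of a mixed state of one mode by a
Bogoliubov transformation. -/
lemma exists_bogoliubov {r : ℝ} {g : ℂ} (hr : 0 ≤ r) (hg : ‖g‖ ^ 2 < r * (r + 1)) :
    ∃ (α ν : ℝ) (β : ℂ), 0 < ν ∧ (α : ℂ) * α - β * conj β = 1 ∧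
      ((r : ℂ) + 1) * α * α + α * conj β * g + α * β * conj g + r * β * conj β = ν + 1 ∧
      ((r : ℂ) + 1) * α * β + g * α * α + conj g * β * β + r * α * β = 0 ∧
      ((r : ℂ) + 1) * β * conj β + g * α * conj β + conj g * α * β + r * α * α = ν := by
  set h : ℝ := r + 1 / 2 with hh
  have hpos : 1 / 4 < h ^ 2 - ‖g‖ ^ 2 := by rw [hh]; nlinarith
  -- The quantity `h² - |g|²` is the symplectic invariant of the mode, so `κ` must equal `ν + 1/2`.
  set κ : ℝ := Real.sqrt (h ^ 2 - ‖g‖ ^ 2) with hκ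
  have hκ2 : κ * κ = h ^ 2 - ‖g‖ ^ 2 := Real.mul_self_sqrt (by linarith)
  have hκ1 : 1 / 2 < κ := by
    rw [hκ]
    refine Real.lt_sqrt_of_sq_lt ?_
    linarith
  have hκ0 : κ ≠ 0 := by positivity
  -- This solves `α² - |β|² = 1` together with `α² + |β|² = h / κ`. With `β = -g t`, the
  -- off-diagonal entry vanishes when `α t = 1 / (2κ)`.
  set α : ℝ := Real.sqrt ((h + κ) / (2 * κ)) with hα
  have hα2 : α * α = (h + κ) / (2 * κ) := Real.mul_self_sqrt (by positivity)
  have hα0 : α ≠ 0 := (Real.sqrt_pos.2 (by positivity)).ne'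
  set t : ℝ := 1 / (2 * κ * α) with ht
  have hαt : α * t = 1 / (2 * κ) := by rw [ht]; field_simp
  have htt : ‖g‖ ^ 2 * (t * t) = (h - κ) / (2 * κ) := by
    have h1 : t * t = 1 / (2 * κ * (h + κ)) := by
      rw [ht, div_mul_div_comm, show 2 * κ * α * (2 * κ * α) = 4 * κ * κ * (α * α) by ring, hα2]
      field_simp
      ring
    have h2 : ‖g‖ ^ 2 = (h - κ) * (h + κ) := by linear_combination hκ2
    have h3 : h + κ ≠ 0 := by positivity
    rw [h1, h2]
    field_simp
  have hgg : g * conj g = ((h ^ 2 - κ * κ : ℝ) : ℂ) := by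
    rw [Complex.mul_conj', hκ2]
    push_cast
    ring
  have hκc : (κ : ℂ) ≠ 0 := by exact_mod_cast hκ0
  push_cast at hgg
  have e1 : (α : ℂ) * α = h * (1 / κ) / 2 + 1 / 2 := by
    have : (α : ℂ) * α = (h + κ) / (2 * κ) := by exact_mod_cast congrArg Complex.ofReal hα2
    rw [this]
    field_simp
  have e2 : (α : ℂ) * t = 1 / κ / 2 := by
    have : (α : ℂ) * t = 1 / (2 * κ) := by exact_mod_cast congrArg Complex.ofReal hαt
    rw [this]
    field_simp
  have e3 : g * conj g * (t * t) = h * (1 / κ) / 2 - 1 / 2 := by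
    have : g * conj g * (t * t) = (h - κ) / (2 * κ) := by
      rw [Complex.mul_conj']
      exact_mod_cast congrArg Complex.ofReal htt
    rw [this]
    field_simp
  have e4 : (r : ℂ) = h - 1 / 2 := by rw [hh]; push_cast; ring
  have e5 : (1 : ℂ) / κ * (κ * κ) = κ := by field_simp
  have hβ : conj (-(g * t)) = -(conj g * t) := by
    rw [map_neg, map_mul, Complex.conj_ofReal]
  refine ⟨α, κ - 1 / 2, -(g * t), by linarith, ?_, ?_, ?_, ?_⟩
  · rw [hβ]
    linear_combination e1 - e3
  · rw [hβ, e4]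
    push_cast
    linear_combination (h + 1 / 2) * e1 - 2 * (g * conj g) * e2 + (h - 1 / 2) * e3
      - 1 / κ * hgg + e5
  · rw [e4]
    linear_combination -2 * h * g * e2 + g * e1 + g * e3
  · rw [hβ, e4]
    push_cast
    linear_combination (h - 1 / 2) * e1 - 2 * (g * conj g) * e2 + (h + 1 / 2) * e3
      - 1 / κ * hgg + e5

end Symplectic

/-- A pure one-mode covariance is the rank-one matrix built from the first column `(a, b)` of `T^♭`,
whence `|M|² = N(N + 1)`; and `M ≠ 0` forces `b ≠ 0`. -/
lemma IsPure.exists_pos {N M : Matrix (Fin 1) (Fin 1) ℂ} (h : IsPure (inputCov N M)) (hM : M ≠ 0) :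
    ∃ (r : ℝ) (g : ℂ), 0 < r ∧ ‖g‖ ^ 2 = r * (r + 1) ∧ N = (r : ℂ) • 1 ∧ M = g • 1 := by
  obtain ⟨ν, ⟨T, ⟨-, h1, -⟩, hT⟩, hν⟩ := h
  have hV : inputCov N M = flat T * fromBlocks 1 0 0 0 * (flat T)ᴴ := by
    have h2 : fromBlocks (diagonal fun i => (ν i : ℂ) + 1) 0 0 (diagonal fun i => (ν i : ℂ))
        = fromBlocks (1 : Matrix (Fin 1) (Fin 1) ℂ) 0 0 0 := by
      simp [hν]
    have h3 : Tᴴ * (flat T)ᴴ = 1 := by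
      rw [← conjTranspose_mul, h1, conjTranspose_one]
    rw [← h2, ← hT, Matrix.mul_assoc, Matrix.mul_assoc, h3, Matrix.mul_one, ← Matrix.mul_assoc, h1,
      Matrix.one_mul]
  set a := flat T (Sum.inl 0) (Sum.inl 0)
  set b := flat T (Sum.inr 0) (Sum.inl 0)
  have hentry : ∀ i j, inputCov N M i j
      = flat T i (Sum.inl 0) * conj (flat T j (Sum.inl 0)) := by
    intro i j
    rw [hV]
    simp [Matrix.mul_apply]
  have e11 : N 0 0 + 1 = a * conj a := by
    simpa [inputCov] using hentry (Sum.inl 0) (Sum.inl 0)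
  have e12 : M 0 0 = a * conj b := by
    simpa [inputCov] using hentry (Sum.inl 0) (Sum.inr 0)
  have e22 : N 0 0 = b * conj b := by
    simpa [inputCov] using hentry (Sum.inr 0) (Sum.inr 0)
  rw [Complex.mul_conj'] at e11 e22
  have hone : ∀ X : Matrix (Fin 1) (Fin 1) ℂ, X = X 0 0 • 1 := by
    intro X
    ext i j
    rw [Subsingleton.elim i 0, Subsingleton.elim j 0]
    simp
  have hab : ‖a‖ ^ 2 = ‖b‖ ^ 2 + 1 := by
    rw [e22] at e11
    exact_mod_cast e11.symm
  refine ⟨‖b‖ ^ 2, M 0 0, ?_, ?_, ?_, hone M⟩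
  · have hb : b ≠ 0 := by
      intro hb
      refine hM ?_
      rw [hone M, e12, hb]
      simp
    positivity
  · rw [e12, norm_mul, RCLike.norm_conj, mul_pow, hab]
    ring
  · rw [hone N, e22]
    push_cast
    simp

/-! ### The stationary covariance and its degeneracy. -/

namespace PassiveQLS

variable {n : ℕ}

/-- The covariance `[r + 1, g Y; conj g Y†, r]`. -/
noncomputable def covOf (r : ℝ) (g : ℂ) (Y : Matrix (Fin n) (Fin n) ℂ) :
    Matrix (Fin n ⊕ Fin n) (Fin n ⊕ Fin n) ℂ :=
  fromBlocks (((r : ℂ) + 1) • 1) (g • Y) (conj g • Yᴴ) ((r : ℂ) • 1)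

variable {G : PassiveQLS 1 n} {Y : Matrix (Fin n) (Fin n) ℂ}

lemma transpose_A_add_conjMat_A (G : PassiveQLS 1 n) :
    G.Aᵀ + conjMat G.A = -(G.Cᵀ * conjMat G.C) := by
  have h := congrArg Matrix.transpose G.A_add_conjTranspose
  rwa [transpose_add, conjTranspose_eq_transpose_conjMat G.A, transpose_transpose, transpose_neg,
    transpose_mul, conjTranspose_eq_transpose_conjMat G.C, transpose_transpose] at h

lemma conjTranspose_sylvester
    (hY : G.A * Y + Y * G.Aᵀ = -(G.Cᴴ * conjMat G.C)) :
    conjMat G.A * Yᴴ + Yᴴ * G.Aᴴ = -(G.Cᵀ * G.C) := by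
  have h := congrArg Matrix.conjTranspose hY
  have h1 : G.Aᵀᴴ = conjMat G.A := by
    rw [conjTranspose_eq_transpose_conjMat]
    rfl
  rwa [conjTranspose_add, conjTranspose_mul, conjTranspose_mul, conjTranspose_neg,
    conjTranspose_mul, conjTranspose_conjTranspose, conjMat_conjTranspose, h1, add_comm] at h

/-- The diagonal blocks of the Lyapunov equation are solved by scalars because `A + A† = -C† C`; the
off-diagonal ones are the Sylvester equation for `Y` and its adjoint. -/
lemma isStationaryCov_covOf (r : ℝ) (g : ℂ)
    (hY : G.A * Y + Y * G.Aᵀ = -(G.Cᴴ * conjMat G.C)) :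
    G.toQLS.IsStationaryCov (inputCov ((r : ℂ) • 1) (g • 1)) (covOf r g Y) := by
  have e1 := G.A_add_conjTranspose
  have e2 := G.transpose_A_add_conjMat_A
  have e3 := conjTranspose_sylvester hY
  rw [← neg_eq_iff_eq_neg] at e1 e2 e3 hY
  have hN : ((r : ℂ) • (1 : Matrix (Fin 1) (Fin 1) ℂ))ᵀ + 1 = ((r : ℂ) + 1) • 1 := by
    rw [transpose_smul, transpose_one, add_smul, one_smul]
  have hM : (g • (1 : Matrix (Fin 1) (Fin 1) ℂ))ᴴ = conj g • 1 := by
    rw [conjTranspose_smul, conjTranspose_one]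
    rfl
  have hCt : G.Cᵀᴴ = conjMat G.C := by
    rw [conjTranspose_eq_transpose_conjMat]
    rfl
  rw [QLS.IsStationaryCov, toQLS_A, toQLS_S, flat_toQLS_C, conjSystem_A, covOf, inputCov, hN, hM,
    conjTranspose_one, Matrix.mul_one, Matrix.one_mul]
  simp only [conjSystem, fromBlocks_conjTranspose, fromBlocks_multiply, conjTranspose_zero,
    Matrix.mul_zero, Matrix.zero_mul, add_zero, zero_add, conjTranspose_conjTranspose,
    conjMat_conjTranspose, fromBlocks_add, Matrix.mul_smul, Matrix.smul_mul, Matrix.mul_one,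
    Matrix.one_mul, smul_zero, hCt]
  rw [← fromBlocks_zero, fromBlocks_inj]
  refine ⟨?_, ?_, ?_, ?_⟩
  · rw [← e1]; module
  · rw [← hY]; module
  · rw [← e3]; module
  · rw [← e2]; module

lemma IsStationaryCov.eq_covOf (hG : G.toQLS.IsHurwitz) {r : ℝ} {g : ℂ}
    (hY : G.A * Y + Y * G.Aᵀ = -(G.Cᴴ * conjMat G.C))
    {P : Matrix (Fin n ⊕ Fin n) (Fin n ⊕ Fin n) ℂ}
    (hP : G.toQLS.IsStationaryCov (inputCov ((r : ℂ) • 1) (g • 1)) P) : P = covOf r g Y := by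
  have h := isStationaryCov_covOf r g hY
  rw [QLS.IsStationaryCov] at h hP
  rw [← sub_eq_zero]
  refine eq_zero_of_mul_add_mul_eq_zero (A := G.toQLS.A) (B := G.toQLS.Aᴴ) hG (fun z hz => ?_) ?_
  · simpa using hG _ (mem_spectrum_conjTranspose.1 hz)
  · rw [Matrix.mul_sub, Matrix.sub_mul, ← sub_eq_zero.2 (hP.trans h.symm)]
    abel

/-- The equation is invariant under transposition, so uniqueness makes its solution symmetric. -/
lemma exists_symmetric_sylvester (hA : ∀ z ∈ spectrum ℂ G.A, z.re < 0) :
    ∃ Y, G.A * Y + Y * G.Aᵀ = -(G.Cᴴ * conjMat G.C) ∧ Yᵀ = Y := by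
  have hAt : ∀ z ∈ spectrum ℂ G.Aᵀ, z.re < 0 := fun z hz => hA z (mem_spectrum_transpose.1 hz)
  obtain ⟨Y, hY⟩ := exists_mul_add_mul_eq hA hAt (-(G.Cᴴ * conjMat G.C))
  refine ⟨Y, hY, ?_⟩
  rw [← sub_eq_zero]
  refine eq_zero_of_mul_add_mul_eq_zero hA hAt ?_
  have h := congrArg Matrix.transpose hY
  rw [transpose_add, transpose_mul, transpose_mul, transpose_transpose, transpose_neg,
    transpose_mul, conjTranspose_eq_transpose_conjMat, transpose_transpose,
    ← conjTranspose_eq_transpose_conjMat, ← hY] at h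
  rw [Matrix.mul_sub, Matrix.sub_mul, ← sub_eq_zero.2 h]
  abel

/-- If `A` has a pair of conjugate eigenvalues (or a real one), some pair of non-zero vectors
is exchanged by `Y` and `Y†`. -/
lemma exists_exchanged_of_mem (hA : ∀ z ∈ spectrum ℂ G.A, z.re < 0)
    (hY : G.A * Y + Y * G.Aᵀ = -(G.Cᴴ * conjMat G.C)) {μ : ℂ}
    (h1 : μ ∈ spectrum ℂ G.A) (h2 : conj μ ∈ spectrum ℂ G.A) :
    ∃ x z, x ≠ 0 ∧ Y *ᵥ z = x ∧ Yᴴ *ᵥ x = z := by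
  obtain ⟨z₀, hz₀, hAz₀⟩ := mem_spectrum_iff_exists_mulVec.1 (mem_spectrum_transpose.2 h1)
  obtain ⟨x, hx0, hAx⟩ := mem_spectrum_iff_exists_mulVec.1 (mem_spectrum_conjTranspose.2 h2)
  have e1 := G.A_add_conjTranspose
  have e2 := G.transpose_A_add_conjMat_A
  have e3 := conjTranspose_sylvester hY
  have hker : ∀ w, G.A *ᵥ w = -μ • w → w = 0 := by
    intro w hw
    by_contra hw0
    have h3 := hA _ (mem_spectrum_iff_exists_mulVec.2 ⟨w, hw0, hw⟩)
    have h4 := hA _ h1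
    rw [Complex.neg_re] at h3
    linarith
  have hker' : ∀ w, conjMat G.A *ᵥ w = -μ • w → w = 0 := by
    intro w hw
    by_contra hw0
    have h3 : -μ ∈ spectrum ℂ G.Aᴴ := by
      rw [← mem_spectrum_transpose, conjTranspose_eq_transpose_conjMat, transpose_transpose]
      exact mem_spectrum_iff_exists_mulVec.2 ⟨w, hw0, hw⟩
    have h4 := hA _ (mem_spectrum_conjTranspose.1 h3)
    have h5 := hA _ h1
    rw [map_neg, Complex.neg_re, Complex.conj_re] at h4
    linarith
  -- If `C^# z₀` vanished, `-μ` would be an eigenvalue of `A^#`, against stability. So `z₀` can be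
  -- rescaled to give `C^# z = C x`.
  have hγ : (conjMat G.C *ᵥ z₀) 0 ≠ 0 := by
    intro hγ
    have hγ' : conjMat G.C *ᵥ z₀ = 0 := funext fun i => by rw [Subsingleton.elim i 0, hγ]; rfl
    refine hz₀ (hker' z₀ ?_)
    have h3 := congrArg (· *ᵥ z₀) e2
    simp only [Matrix.add_mulVec, Matrix.neg_mulVec, ← Matrix.mulVec_mulVec, hγ',
      Matrix.mulVec_zero, neg_zero, hAz₀] at h3
    rw [neg_smul]
    exact eq_neg_of_add_eq_zero_right h3
  set z := ((G.C *ᵥ x) 0 / (conjMat G.C *ᵥ z₀) 0) • z₀ with hz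
  have hCz : conjMat G.C *ᵥ z = G.C *ᵥ x := by
    ext i
    rw [Subsingleton.elim i 0, hz, Matrix.mulVec_smul, Pi.smul_apply, smul_eq_mul,
      div_mul_cancel₀ _ hγ]
  have hAz : G.Aᵀ *ᵥ z = μ • z := by
    rw [hz, Matrix.mulVec_smul, hAz₀, smul_comm]
  have f1 := congrArg (· *ᵥ x) e1
  have f2 := congrArg (· *ᵥ z) e2
  have f3 := congrArg (· *ᵥ x) e3
  have f4 := congrArg (· *ᵥ z) hY
  simp only [Matrix.add_mulVec, Matrix.neg_mulVec, ← Matrix.mulVec_mulVec, hAx, hAz, hCz,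
    Matrix.mulVec_smul] at f1 f2 f3 f4
  -- The differences `Y z - x` and `Y† x - z` are annihilated by `A + μ` and `A^# + μ`, which are
  -- injective.
  refine ⟨x, z, hx0, ?_, ?_⟩
  · refine sub_eq_zero.1 (hker _ ?_)
    rw [Matrix.mulVec_sub]
    linear_combination (norm := module) f4 - f1
  · refine sub_eq_zero.1 (hker' _ ?_)
    rw [Matrix.mulVec_sub]
    linear_combination (norm := module) f3 - f2

/-- If `Y` is not a strict contraction, `A` has a pair of conjugate eigenvalues (or a real one). -/
lemma exists_mem_of_one_le (hA : ∀ z ∈ spectrum ℂ G.A, z.re < 0)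
    (hY : G.A * Y + Y * G.Aᵀ = -(G.Cᴴ * conjMat G.C)) {d : ℝ}
    (hd : 1 ≤ d) {v : Fin n → ℂ} (hv : v ≠ 0) (hYv : (Y * Yᴴ) *ᵥ v = (d : ℂ) • v) :
    ∃ μ ∈ spectrum ℂ G.A, conj μ ∈ spectrum ℂ G.A := by
  -- This column is chosen so that `1 - Y Y†` satisfies the Lyapunov equation with source `b b†`.
  set b : Matrix (Fin n) (Fin 1) ℂ := G.Cᴴ - Y * G.Cᵀ with hb
  have e1 := G.A_add_conjTranspose
  have e2 := G.transpose_A_add_conjMat_A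
  have e3 := conjTranspose_sylvester hY
  have hbh : bᴴ = G.C - conjMat G.C * Yᴴ := by
    rw [hb, conjTranspose_sub, conjTranspose_mul, conjTranspose_conjTranspose]
    congr 2
  have hQ : G.A * (1 - Y * Yᴴ) + (1 - Y * Yᴴ) * G.Aᴴ = -(b * bᴴ) := by
    have hbb : b * bᴴ = G.Cᴴ * G.C - G.Cᴴ * conjMat G.C * Yᴴ - Y * (G.Cᵀ * G.C)
        + Y * (G.Cᵀ * conjMat G.C) * Yᴴ := by
      rw [hbh, hb, Matrix.sub_mul, Matrix.mul_sub, Matrix.mul_sub]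
      simp only [Matrix.mul_assoc]
      abel
    rw [hbb]
    linear_combination (norm := noncomm_ring) e1 - hY * Yᴴ - Y * e3 + Y * e2 * Yᴴ
  have hQh : (1 - Y * Yᴴ)ᴴ = 1 - Y * Yᴴ := by
    rw [conjTranspose_sub, conjTranspose_one, conjTranspose_mul, conjTranspose_conjTranspose]
  obtain ⟨μ, x, hx0, hQx, hbx, hx⟩ := exists_eigenvector_of_lyapunov hA e1 hQ hQh
    (q := 1 - d) (by linarith) hv (by
      rw [Matrix.sub_mulVec, Matrix.one_mulVec, hYv]
      push_cast
      rw [sub_smul, one_smul])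
  -- On the kernel of `1 - Y Y†`, `Y z = x`, and `b† x = 0` reads `C x = C^# z`. The adjoint
  -- Sylvester equation then reduces to `Aᵀ z = μ z`, so `μ` is also an eigenvalue of `A`.
  set z := Yᴴ *ᵥ x with hz
  have hYz : Y *ᵥ z = x := by
    rw [hz, Matrix.mulVec_mulVec]
    rw [Matrix.sub_mulVec, Matrix.one_mulVec, sub_eq_zero] at hQx
    exact hQx.symm
  have hz0 : z ≠ 0 := fun h => hx0 (by rw [← hYz, h, Matrix.mulVec_zero])
  have hCx : G.C *ᵥ x = conjMat G.C *ᵥ z := by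
    rw [hbh, Matrix.sub_mulVec, sub_eq_zero, ← Matrix.mulVec_mulVec] at hbx
    exact hbx
  refine ⟨μ, ?_, mem_spectrum_conjTranspose.1 (mem_spectrum_iff_exists_mulVec.2 ⟨x, hx0, hx⟩)⟩
  refine mem_spectrum_transpose.1 (mem_spectrum_iff_exists_mulVec.2 ⟨z, hz0, ?_⟩)
  have h1 := congrArg (· *ᵥ x) e3
  have h2 := congrArg (· *ᵥ z) e2
  simp only [Matrix.add_mulVec, Matrix.neg_mulVec, ← Matrix.mulVec_mulVec, hx, Matrix.mulVec_smul,
    hCx] at h1 h2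
  rw [← hz, ← h2, add_comm] at h1
  exact (add_right_cancel h1).symm

end PassiveQLS

/-- The Takagi unitary of `Y` decouples the modes, and each is then brought to normal form by its
own Bogoliubov transformation. -/
lemma isFullyMixed_covOf {n : ℕ} {Y : Matrix (Fin n) (Fin n) ℂ} (hY : Yᵀ = Y) {r : ℝ} {g : ℂ}
    (hr : 0 < r) (hg : ‖g‖ ^ 2 = r * (r + 1))
    (hYv : ∀ d : ℝ, 1 ≤ d → ∀ v ≠ 0, (Y * Yᴴ) *ᵥ v ≠ (d : ℂ) • v) :
    IsFullyMixed (PassiveQLS.covOf r g Y) := by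
  obtain ⟨U, d, hU, hUd⟩ := exists_takagi hY
  set D : Matrix (Fin n) (Fin n) ℂ := diagonal fun i => (d i : ℂ) with hD
  have hDc : conjMat D = D := by
    rw [hD, conjMat, diagonal_map (map_zero _)]
    simp
  have hcc : ∀ X : Matrix (Fin n) (Fin n) ℂ, conjMat (conjMat X) = X := by
    intro X
    ext i j
    simp [conjMat]
  have hYh : Yᴴ = conjMat Y := by
    rw [conjTranspose_eq_transpose_conjMat, conjMat, ← transpose_map, hY]
  have hYU : Yᴴ * U = conjMat U * D := by
    rw [hYh, ← hcc U, ← conjMat_mul, hUd, conjMat_mul, hDc, hcc]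
  -- The `i`-th column of `U` is an eigenvector of `Y Y†` with eigenvalue `dᵢ²`.
  have hd : ∀ i, d i ^ 2 < 1 := by
    intro i
    by_contra! hi
    refine hYv (d i ^ 2) hi (U *ᵥ Pi.single i 1) (fun h => ?_) ?_
    · have h1 := congrArg (Uᴴ *ᵥ ·) h
      simp only [Matrix.mulVec_mulVec, hU, Matrix.one_mulVec, Matrix.mulVec_zero] at h1
      simpa using congrFun h1 i
    · have h1 : Y * Yᴴ * U = U * (D * D) := by
        rw [Matrix.mul_assoc, hYU, ← Matrix.mul_assoc, hUd, Matrix.mul_assoc]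
      rw [Matrix.mulVec_mulVec, h1, ← Matrix.mulVec_mulVec, ← Matrix.mulVec_smul]
      congr 1
      ext j
      by_cases hj : j = i
      · subst hj
        simp [hD, sq]
      · simp [hD, hj]
  have hb : ∀ i, ‖g * d i‖ ^ 2 < r * (r + 1) := by
    intro i
    rw [norm_mul, mul_pow, hg, Complex.norm_real, Real.norm_eq_abs, sq_abs]
    exact mul_lt_of_lt_one_right (by positivity) (hd i)
  choose α ν β hν h0 h11 h12 h22 using fun i => exists_bogoliubov hr.le (hb i)
  have hUt : conjMat Uᴴ = Uᵀ := by
    rw [conjTranspose_eq_transpose_conjMat]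
    exact congrArg transpose (hcc U)
  have hUU : Uᵀ * conjMat U = 1 := by
    rw [← hUt, ← conjMat_mul, hU]
    simp [conjMat, Matrix.map_one]
  have hrot : dbl Uᴴ 0 * PassiveQLS.covOf r g Y * (dbl Uᴴ 0)ᴴ
      = fromBlocks (diagonal fun _ => (r : ℂ) + 1) (diagonal fun i => g * d i)
        (diagonal fun i => conj g * d i) (diagonal fun _ => (r : ℂ)) := by
    have h0' : conjMat (0 : Matrix (Fin n) (Fin n) ℂ) = 0 := Matrix.map_zero _ (map_zero _)
    have hUth : Uᵀᴴ = conjMat U := by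
      rw [← conjMat_conjTranspose, conjTranspose_conjTranspose]
    have e1 : Uᴴ * (Y * conjMat U) = D := by
      rw [hUd, ← Matrix.mul_assoc, hU, Matrix.one_mul]
    have e2 : Uᵀ * (Yᴴ * U) = D := by
      rw [hYU, ← Matrix.mul_assoc, hUU, Matrix.one_mul]
    have hdiag : ∀ c : ℂ, c • D = diagonal fun i => c * (d i : ℂ) := by
      intro c
      rw [hD, ← diagonal_smul]
      rfl
    simp only [dbl, h0', hUt, PassiveQLS.covOf, fromBlocks_conjTranspose, hUth,
      conjTranspose_zero, conjTranspose_conjTranspose, fromBlocks_multiply, Matrix.zero_mul,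
      Matrix.mul_zero, add_zero, zero_add, Matrix.mul_smul, Matrix.smul_mul, Matrix.mul_one,
      Matrix.mul_assoc, hU, hUU, e1, e2, hdiag, smul_zero]
    rw [smul_one_eq_diagonal, smul_one_eq_diagonal]
  refine ⟨ν, ⟨dbl (diagonal fun i => (α i : ℂ)) (diagonal β) * dbl Uᴴ 0,
    (isSymplectic_dbl_diagonal h0).mul (isSymplectic_dbl_conjTranspose hU), ?_⟩, hν⟩
  rw [conjTranspose_mul, Matrix.mul_assoc, Matrix.mul_assoc, ← Matrix.mul_assoc (dbl Uᴴ 0),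
    ← Matrix.mul_assoc (dbl Uᴴ 0 * _), hrot]
  have hα : conjMat (diagonal fun i => (α i : ℂ)) = diagonal fun i => (α i : ℂ) := by
    rw [conjMat, diagonal_map (map_zero _)]
    simp
  have hβ : conjMat (diagonal β) = diagonal fun i => conj (β i) := diagonal_map (map_zero _)
  simp only [dbl, hα, hβ, fromBlocks_conjTranspose, diagonal_conjTranspose, fromBlocks_multiply,
    diagonal_mul_diagonal, diagonal_add]
  rw [fromBlocks_inj]
  refine ⟨?_, ?_, ?_, ?_⟩ <;> try rw [← diagonal_zero]
  all_goals
    congr 1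
    ext i
    simp only [Pi.star_apply, RCLike.star_def, Complex.conj_ofReal, Complex.conj_conj]
  · have h := h11 i
    simp only [map_mul, Complex.conj_ofReal] at h
    linear_combination h
  · have h := h12 i
    simp only [map_mul, Complex.conj_ofReal] at h
    linear_combination h
  · have h := congrArg (starRingEnd ℂ) (h12 i)
    simp only [map_mul, map_add, map_one, map_zero, Complex.conj_ofReal, Complex.conj_conj] at h
    linear_combination h
  · have h := h22 i
    simp only [map_mul, Complex.conj_ofReal] at h
    linear_combination h

/-- The exchanged pair yields a null vector of the covariance, whereas the normal form of a fully
mixed state has non-zero determinant. -/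
lemma not_isFullyMixed_covOf {n : ℕ} {Y : Matrix (Fin n) (Fin n) ℂ} {r : ℝ} {g : ℂ} (hr : 0 < r)
    (hg : ‖g‖ ^ 2 = r * (r + 1)) {x z : Fin n → ℂ} (hx : x ≠ 0) (hYz : Y *ᵥ z = x)
    (hYx : Yᴴ *ᵥ x = z) : ¬ IsFullyMixed (PassiveQLS.covOf r g Y) := by
  rintro ⟨ν, ⟨T, -, hT⟩, hν⟩
  have hg0 : g ≠ 0 := by
    rintro rfl
    rw [norm_zero] at hg
    nlinarith
  have hgg : g * conj g = r * (r + 1) := by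
    rw [Complex.mul_conj']
    exact_mod_cast congrArg Complex.ofReal hg
  -- The coefficients cancel the upper block; the lower one then cancels because `|g|² = r(r + 1)`.
  set w : Fin n ⊕ Fin n → ℂ := Sum.elim (g • x) (-((r : ℂ) + 1) • z) with hw
  have hPw : PassiveQLS.covOf r g Y *ᵥ w = 0 := by
    rw [PassiveQLS.covOf, hw, fromBlocks_mulVec]
    simp only [Sum.elim_comp_inl, Sum.elim_comp_inr, Matrix.smul_mulVec, Matrix.mulVec_smul, hYz,
      hYx, Matrix.one_mulVec]
    rw [← Sum.elim_zero_zero]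
    congr 1
    · module
    · rw [smul_smul, hgg]
      module
  have hdet : (PassiveQLS.covOf r g Y).det = 0 := by
    refine exists_mulVec_eq_zero_iff.1 ⟨w, fun h => hx ?_, hPw⟩
    have h2 : g • x = 0 := funext fun i => congrFun h (Sum.inl i)
    exact (smul_eq_zero.1 h2).resolve_left hg0
  have h2 := congrArg Matrix.det hT
  rw [det_mul, det_mul, hdet, mul_zero, zero_mul, det_fromBlocks_zero₂₁, det_diagonal,
    det_diagonal, eq_comm, mul_eq_zero, Finset.prod_eq_zero_iff, Finset.prod_eq_zero_iff] at h2
  rcases h2 with ⟨i, -, h⟩ | ⟨i, -, h⟩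
  · have h3 : ν i + 1 = 0 := by exact_mod_cast h
    linarith [hν i]
  · have h3 : ν i = 0 := by exact_mod_cast h
    linarith [hν i]

/-! ### The spectral criterion for full mixedness. -/

namespace PassiveQLS

variable {n : ℕ} {G : PassiveQLS 1 n}

lemma spectrum_inter_eq_empty_iff :
    spectrum ℂ G.A ∩ spectrum ℂ G.Aᴴ = ∅ ↔ ∀ z ∈ spectrum ℂ G.A, conj z ∉ spectrum ℂ G.A := by
  simp only [Set.eq_empty_iff_forall_notMem, Set.mem_inter_iff, mem_spectrum_conjTranspose, not_and]

lemma hasFullyMixedStationaryState_iff (hG : G.toQLS.IsHurwitz) {N M : Matrix (Fin 1) (Fin 1) ℂ}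
    (hpure : IsPure (inputCov N M)) (hM : M ≠ 0) :
    G.toQLS.HasFullyMixedStationaryState (inputCov N M)
      ↔ ∀ z ∈ spectrum ℂ G.A, conj z ∉ spectrum ℂ G.A := by
  have hA : ∀ z ∈ spectrum ℂ G.A, z.re < 0 := fun z hz =>
    G.isHurwitz_iff.1 hG z ((mem_spectrum_iff_mem_roots _ _).1 hz)
  obtain ⟨r, g, hr, hg, rfl, rfl⟩ := hpure.exists_pos hM
  obtain ⟨Y, hY, hYt⟩ := exists_symmetric_sylvester hA
  constructor
  · rintro ⟨P, hP, hmix⟩ z hz hz'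
    obtain ⟨x, w, hx, hYw, hYx⟩ := exists_exchanged_of_mem hA hY hz hz'
    rw [IsStationaryCov.eq_covOf hG hY hP] at hmix
    exact not_isFullyMixed_covOf hr hg hx hYw hYx hmix
  · intro h
    refine ⟨covOf r g Y, isStationaryCov_covOf r g hY, isFullyMixed_covOf hYt hr hg ?_⟩
    intro d hd v hv hYv
    obtain ⟨μ, hμ, hμ'⟩ := exists_mem_of_one_le hA hY hd hv hYv
    exact h μ hμ hμ'

end PassiveQLS

end QuantumLinear

theorem theorem4 {n : ℕ} (G : QuantumLinear.PassiveQLS 1 n) (hG : G.toQLS.IsHurwitz)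
    (N M : Matrix (Fin 1) (Fin 1) ℂ)
    (hpure : QuantumLinear.IsPure (QuantumLinear.inputCov N M)) (hM : M ≠ 0) :
    List.TFAE
      [ G.toQLS.IsGloballyMinimal (QuantumLinear.inputCov N M),
        G.toQLS.HasFullyMixedStationaryState (QuantumLinear.inputCov N M),
        spectrum ℂ G.A ∩ spectrum ℂ G.A.conjTranspose = ∅,
        (¬ ∃ z ∈ spectrum ℂ G.A, z.im = 0) ∧
          ¬ ∃ z ∈ spectrum ℂ G.A, z.im ≠ 0 ∧ starRingEnd ℂ z ∈ spectrum ℂ G.A ] ∧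
    ∀ l : List ℂ, (l : Multiset ℂ) = QuantumLinear.unpairedEigenvalues G.A →
      (QuantumLinear.PassiveQLS.cascade l).toQLS.IsHurwitz ∧
      QuantumLinear.QLS.SamePowerSpectrum (QuantumLinear.inputCov N M) G.toQLS
        (QuantumLinear.PassiveQLS.cascade l).toQLS ∧
      (QuantumLinear.PassiveQLS.cascade l).toQLS.IsGloballyMinimal
        (QuantumLinear.inputCov N M) := by
  refine ⟨?_, fun l hl => ⟨QuantumLinear.cascade_unpairedEigenvalues_isHurwitz hG hl,
    QuantumLinear.cascade_unpairedEigenvalues_samePowerSpectrum hG hl N M,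
    QuantumLinear.cascade_unpairedEigenvalues_isGloballyMinimal hG hl N hM⟩⟩
  tfae_have 3 ↔ 2 := by
    rw [QuantumLinear.PassiveQLS.spectrum_inter_eq_empty_iff,
      QuantumLinear.PassiveQLS.hasFullyMixedStationaryState_iff hG hpure hM]
  tfae_have 1 ↔ 3 := by
    rw [QuantumLinear.PassiveQLS.spectrum_inter_eq_empty_iff]
    simp only [QuantumLinear.mem_spectrum_iff_mem_roots]
    exact ⟨QuantumLinear.disjoint_of_isGloballyMinimal hG,
      G.isGloballyMinimal_of_disjoint hG N hM⟩
  tfae_have 3 ↔ 4 := by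
    rw [QuantumLinear.PassiveQLS.spectrum_inter_eq_empty_iff]
    constructor
    · intro h
      refine ⟨fun ⟨z, hz, h0⟩ => h z hz ?_, fun ⟨z, hz, _, hz'⟩ => h z hz hz'⟩
      rwa [Complex.conj_eq_iff_im.2 h0]
    · rintro ⟨h1, h2⟩ z hz hz'
      exact h2 ⟨z, hz, fun h0 => h1 ⟨z, hz, h0⟩, hz'⟩
  tfae_finish
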